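/- Let $s\ge 1$, let $|\cdot|$ be any norm on $\mathbb{R}^m$, let $f:\mathbb{R}^m\to\mathbb{R}^m$ be of class $C^{s+1}$, and let $y:[t_0,T]\to\mathbb{R}^m$, $t_0<T$, solve $$\dot y(t)=f(y(t)),\quad t\in[t_0,T],\qquad y(t_0)=y_0 .$$ For an integer $N\ge 1$ put $h=(T-t_0)/N$ and $t_n=t_0+nh$, $n=0,\dots,N$. Let $P_j$, $j\ge0$, be the Legendre polynomials on $[0,1]$ normalized by $\int_0^1P_i(x)P_j(x)\,dx=\delta_{ij}$, $\deg P_j=j$, and for $z:[0,h]\to\mathbb{R}^m$ let $$\gamma_j(z)=\int_0^1P_j(\zeta)f(z(\zeta h))\,d\zeta .$$ An HBVM$(\infty,s)$ approximation is a function $\sigma:[t_0,T]\to\mathbb{R}^m$ with $\sigma(t_0)=y_0$ such that, for $n=1,\dots,N$, the restriction $\sigma_n(ch):=\sigma(t_{n-1}+ch)$, $c\in[0,1]$, is a polynomial of degree at most $s$ and $$\dot\sigma_n(ch)=\sum_{j=0}^{s-1}P_j(c)\,\gamma_j(\sigma_n),\qquad c\in[0,1].$$ Write $y_n:=\sigma(t_n)$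 and $\hat\sigma_n(ch):=y(t_{n-1}+ch)$. Then there is a constant $C$, independent of $N$ and $n$, such that for every $R>\max_{t\in[t_0,T]}|y(t)|$ there is an $N_0$ such that for all $N\ge N_0$ there is exactly one HBVM$(\infty,s)$ approximation $\sigma$ with $|\sigma(t)|\le R$ on $[t_0,T]$, and it satisfies, for all $n=1,\dots,N$, $$\bigl|\,(y(t_n)-y_n)-(y(t_{n-1})-y_{n-1})\,\bigr|\le C\,h^{2s+1},\qquad \max_{c\in[0,1]}|\hat\sigma_n(ch)-\sigma_n(ch)|\le C\,h^{s+1}.$$ In particular $|y(t_1)-y_1|\le C\,h^{2s+1}$, and the method has order $2s$: $|y(t_n)-y_n|\le C\,h^{2s}$ for $n=0,\dots,N$. -/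

import Mathlib

open Set

noncomputable section

namespace HBVM

/-! ### The orthonormal Legendre basis on `[0, 1]` -/

/-- The Legendre polynomial of degree `j`, shifted to `[0, 1]` and scaled to have unit `L²` norm. -/
def legendre (j : ℕ) : Polynomial ℝ :=
  Polynomial.C (Real.sqrt (2 * j + 1) * (-1) ^ j) *
    (Polynomial.shiftedLegendre j).map (Int.castRingHom ℝ)

theorem natDegree_legendre (j : ℕ) : (legendre j).natDegree = j := by
  have h0 : Real.sqrt (2 * j + 1) * (-1) ^ j ≠ 0 :=
    mul_ne_zero (Real.sqrt_ne_zero'.2 (by positivity)) (pow_ne_zero _ (by norm_num))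
  rw [legendre, Polynomial.natDegree_C_mul h0,
    Polynomial.natDegree_map_eq_of_injective (RingHom.injective_int _),
    Polynomial.natDegree_shiftedLegendre]

open Polynomial in
theorem integral_derivative (p : ℝ[X]) :
    ∫ x in (0 : ℝ)..1, (derivative p).eval x = p.eval 1 - p.eval 0 :=
  intervalIntegral.integral_eq_sub_of_hasDerivAt (fun x _ => p.hasDerivAt x)
    ((derivative p).continuous.intervalIntegrable 0 1)

open Polynomial in
theorem integral_by_parts (p q : ℝ[X]) (h0 : p.eval 0 = 0) (h1 : p.eval 1 = 0) :
    ∫ x in (0 : ℝ)..1, (derivative p * q).eval x =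
      -∫ x in (0 : ℝ)..1, (p * derivative q).eval x := by
  have h := integral_derivative (p * q)
  simp only [derivative_mul, eval_add] at h
  rw [intervalIntegral.integral_add ((derivative p * q).continuous.intervalIntegrable 0 1)
    ((p * derivative q).continuous.intervalIntegrable 0 1)] at h
  simp only [eval_mul, h0, h1] at h ⊢
  linarith

open Polynomial in
theorem integral_beta (b : ℕ) : ∀ a : ℕ,
    (∫ x in (0 : ℝ)..1, ((X : ℝ[X]) ^ a * (1 - X) ^ b).eval x) * ((a + b + 1).factorial : ℝ) =
      a.factorial * b.factorial := by
  induction b with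
  | zero =>
    intro a
    simp only [pow_zero, mul_one, eval_pow, eval_X, integral_pow, add_zero, Nat.factorial_zero,
      Nat.cast_one, Nat.factorial_succ, Nat.cast_mul]
    have : (a : ℝ) + 1 ≠ 0 := by positivity
    push_cast
    field_simp
    simp
  | succ b ih =>
    intro a
    have h := integral_derivative ((X : ℝ[X]) ^ (a + 1) * (1 - X) ^ (b + 1))
    have e : derivative ((X : ℝ[X]) ^ (a + 1) * (1 - X) ^ (b + 1)) =
        C ((a : ℝ) + 1) * (X ^ a * (1 - X) ^ (b + 1)) -
          C ((b : ℝ) + 1) * (X ^ (a + 1) * (1 - X) ^ b) := by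
      simp only [derivative_mul, derivative_pow, derivative_X, derivative_sub, derivative_one]
      simp
      ring
    rw [e] at h
    simp only [eval_sub (R := ℝ), eval_C_mul] at h
    rw [intervalIntegral.integral_sub
      (((C ((a : ℝ) + 1) * (X ^ a * (1 - X) ^ (b + 1))).continuous.intervalIntegrable 0 1).congr
        (by intro x _; simp))
      (((C ((b : ℝ) + 1) * (X ^ (a + 1) * (1 - X) ^ b)).continuous.intervalIntegrable 0 1).congr
        (by intro x _; simp)),
      intervalIntegral.integral_const_mul, intervalIntegral.integral_const_mul] at h
    have h2 := ih (a + 1)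
    have h3 : a + 1 + b + 1 = a + (b + 1) + 1 := by ring
    rw [h3, Nat.factorial_succ a] at h2
    simp only [eval_mul, eval_pow, eval_X, eval_sub, eval_one] at h h2 ⊢
    rw [Nat.factorial_succ b]
    push_cast at h h2 ⊢
    have ha : (a : ℝ) + 1 ≠ 0 := by positivity
    apply mul_left_cancel₀ ha
    simp at h
    linear_combination ((a + (b + 1) + 1).factorial : ℝ) * h + ((b : ℝ) + 1) * h2

open Polynomial in
theorem integral_rodrigues (n : ℕ) (q : ℝ[X]) (k : ℕ) (hk : k ≤ n) :
    ∫ x in (0 : ℝ)..1, (derivative^[k] ((X : ℝ[X]) ^ n * (1 - X) ^ n) * q).eval x =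
      (-1) ^ k * ∫ x in (0 : ℝ)..1, (X ^ n * (1 - X) ^ n * derivative^[k] q).eval x := by
  induction k generalizing q with
  | zero => simp
  | succ k ih =>
    have hz : ∀ r : ℝ[X], r ^ n ∣ (X : ℝ[X]) ^ n * (1 - X) ^ n → ∀ x : ℝ, r.eval x = 0 →
        (derivative^[k] ((X : ℝ[X]) ^ n * (1 - X) ^ n)).eval x = 0 := by
      intro r hr x hx
      obtain ⟨g, hg⟩ := pow_sub_dvd_iterate_derivative_of_pow_dvd k hr
      rw [hg, eval_mul, eval_pow, hx, zero_pow (by omega), zero_mul]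
    rw [Function.iterate_succ_apply', integral_by_parts _ _
      (hz X (Dvd.intro _ rfl) 0 (by simp)) (hz (1 - X) (Dvd.intro_left _ rfl) 1 (by simp)),
      ih _ (by omega), Function.iterate_succ_apply, pow_succ]
    ring

open Polynomial in
theorem integral_shiftedLegendre_mul (n : ℕ) (q : ℝ[X]) :
    (n.factorial : ℝ) *
        ∫ x in (0 : ℝ)..1, ((shiftedLegendre n).map (Int.castRingHom ℝ) * q).eval x =
      (-1) ^ n * ∫ x in (0 : ℝ)..1, (X ^ n * (1 - X) ^ n * derivative^[n] q).eval x := by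
  rw [← integral_rodrigues n q n le_rfl, ← intervalIntegral.integral_const_mul]
  have h := congrArg (Polynomial.map (Int.castRingHom ℝ)) (factorial_mul_shiftedLegendre_eq n)
  rw [← iterate_derivative_map] at h
  simp only [Polynomial.map_mul, Polynomial.map_pow, Polynomial.map_sub, Polynomial.map_one,
    map_X, Polynomial.map_natCast] at h
  rw [← h]
  simp [mul_assoc]

open Polynomial in
theorem integral_legendre_mul_of_lt {i j : ℕ} (hij : i < j) :
    ∫ x in (0 : ℝ)..1, (legendre i).eval x * (legendre j).eval x = 0 := by
  have h := integral_shiftedLegendre_mul j (legendre i)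
  rw [iterate_derivative_eq_zero (by rw [natDegree_legendre]; exact hij)] at h
  simp only [mul_zero, eval_zero, intervalIntegral.integral_zero] at h
  have h := (mul_eq_zero.1 h).resolve_left (by positivity)
  have e : ∀ x : ℝ, (legendre i).eval x * (legendre j).eval x =
      (Real.sqrt (2 * j + 1) * (-1) ^ j) *
        ((shiftedLegendre j).map (Int.castRingHom ℝ) * legendre i).eval x := by
    intro x
    rw [legendre, legendre]
    simp only [eval_mul, eval_C]
    ring
  simp only [e]
  rw [intervalIntegral.integral_const_mul, h, mul_zero]

open Polynomial in
theorem integral_legendre_mul_self (j : ℕ) :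
    ∫ x in (0 : ℝ)..1, (legendre j).eval x * (legendre j).eval x = 1 := by
  set S : ℝ[X] := (shiftedLegendre j).map (Int.castRingHom ℝ) with hS
  have hdeg : S.natDegree = j := by
    rw [hS, natDegree_map_eq_of_injective (RingHom.injective_int _), natDegree_shiftedLegendre]
  have hD : derivative^[j] S =
      C ((j.factorial : ℝ) * ((-1) ^ j * ((j + j).choose j : ℝ))) := by
    have h0 : (derivative^[j] S).natDegree = 0 := by
      have := natDegree_iterate_derivative S j
      omega
    rw [eq_C_of_natDegree_eq_zero h0, coeff_iterate_derivative]
    simp [hS, coeff_shiftedLegendre, Nat.descFactorial_self]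
  have h := integral_shiftedLegendre_mul j S
  rw [← hS, hD] at h
  have hb := integral_beta j j
  have e1 : ∀ x : ℝ, (X ^ j * (1 - X) ^ j *
      C ((j.factorial : ℝ) * ((-1) ^ j * ((j + j).choose j : ℝ)))).eval x =
      ((j.factorial : ℝ) * ((-1) ^ j * ((j + j).choose j : ℝ))) *
        ((X : ℝ[X]) ^ j * (1 - X) ^ j).eval x := by
    intro x
    simp only [eval_mul, eval_C]
    ring
  simp only [e1] at h
  rw [intervalIntegral.integral_const_mul] at h
  have e2 : ∀ x : ℝ, (legendre j).eval x * (legendre j).eval x =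
      (2 * j + 1) * (S * S).eval x := by
    intro x
    have hs : Real.sqrt (2 * j + 1) * Real.sqrt (2 * j + 1) = 2 * j + 1 :=
      Real.mul_self_sqrt (by positivity)
    have hm : ((-1 : ℝ) ^ j) * (-1) ^ j = 1 := by rw [← mul_pow]; simp
    rw [legendre, ← hS]
    simp only [eval_mul, eval_C]
    linear_combination (S.eval x * S.eval x) * ((-1) ^ j * (-1) ^ j) * hs +
      (S.eval x * S.eval x) * (2 * j + 1) * hm
  simp only [e2]
  rw [intervalIntegral.integral_const_mul]
  set I := ∫ x in (0 : ℝ)..1, (S * S).eval x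
  set B := ∫ x in (0 : ℝ)..1, ((X : ℝ[X]) ^ j * (1 - X) ^ j).eval x
  have hm : ((-1 : ℝ) ^ j) * (-1) ^ j = 1 := by rw [← mul_pow]; simp
  have hf : (j.factorial : ℝ) ≠ 0 := by positivity
  have hI : I = ((j + j).choose j : ℝ) * B := by
    apply mul_left_cancel₀ hf
    linear_combination h + (j.factorial : ℝ) * ((j + j).choose j : ℝ) * B * hm
  have hc : ((j + j).choose j : ℝ) * j.factorial * j.factorial = (j + j).factorial := by
    exact_mod_cast Nat.add_choose_mul_factorial_mul_factorial j j
  rw [Nat.factorial_succ] at hb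
  push_cast at hb
  have hg : (j.factorial : ℝ) * j.factorial ≠ 0 := mul_ne_zero hf hf
  rw [hI]
  apply mul_left_cancel₀ hg
  linear_combination hb + (2 * j + 1) * B * hc

/-- `∫₀¹ P_i P_j = δ_{ij}`. -/
theorem integral_legendre_mul_legendre (i j : ℕ) :
    ∫ x in (0 : ℝ)..1, (legendre i).eval x * (legendre j).eval x = if i = j then 1 else 0 := by
  rcases lt_trichotomy i j with h | h | h
  · rw [if_neg h.ne, integral_legendre_mul_of_lt h]
  · subst h
    rw [if_pos rfl, integral_legendre_mul_self]
  · rw [if_neg h.ne']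
    simpa only [mul_comm] using integral_legendre_mul_of_lt h

/-! ### The differential problem and its polynomial approximation -/

variable {E : Type*} [NormedAddCommGroup E] [NormedSpace ℝ E]

/-- `y' = f(y)` on `[t₀, T]`, `y(t₀) = y₀`, with one-sided derivatives at the end points. -/
structure IsODESolution (f : E → E) (t₀ T : ℝ) (y₀ : E) (y : ℝ → E) : Prop where
  initial : y t₀ = y₀
  deriv : ∀ t ∈ Icc t₀ T, HasDerivWithinAt y (f (y t)) (Icc t₀ T) t

/-- The time step `h = (T - t₀) / N`. -/
def step (t₀ T : ℝ) (N : ℕ) : ℝ := (T - t₀) / N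

/-- The mesh point `t_n = t₀ + n h`, with `h = (T - t₀) / N`. -/
def mesh (t₀ T : ℝ) (N n : ℕ) : ℝ := t₀ + n * step t₀ T N

/-- The restriction `u_n(τ) = u(t_{n-1} + τ)`, `τ ∈ [0, h]`, of `u` to the `n`-th subinterval
`[t_{n-1}, t_n]`; used for `1 ≤ n ≤ N`. -/
def piece (t₀ T : ℝ) (N n : ℕ) (u : ℝ → E) (τ : ℝ) : E := u (mesh t₀ T N (n - 1) + τ)

/-- The Fourier coefficient `γ_j(z) = ∫₀¹ P_j(ζ) f(z(ζ h)) dζ`. -/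
def fourierCoeff (f : E → E) (h : ℝ) (j : ℕ) (z : ℝ → E) : E :=
  ∫ ζ in (0 : ℝ)..1, (legendre j).eval ζ • f (z (ζ * h))

/-- On the set `S`, `z` is a polynomial of degree at most `s` with coefficients in `E`. -/
def IsPolynomialOn (s : ℕ) (S : Set ℝ) (z : ℝ → E) : Prop :=
  ∃ a : ℕ → E, ∀ τ ∈ S, z τ = ∑ k ∈ Finset.range (s + 1), τ ^ k • a k

/-- `σ` is a piecewise polynomial approximation on `[t₀, T]` with `N` steps: `σ(t₀) = y₀`, and for
`n = 1, …, N` the restriction `σ_n` has degree at most `s` and satisfies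
`σ_n'(c h) = ∑_{j<s} P_j(c) γ_j(σ_n)` for `c ∈ [0, 1]`. The mesh values are `y_n = σ(t_n)`;
as `σ` is a single function, `σ_n(0) = y_{n-1}` and `σ_n(h) = y_n`. -/
structure IsHBVMApprox (f : E → E) (t₀ T : ℝ) (y₀ : E) (s N : ℕ) (σ : ℝ → E) : Prop where
  initial : σ t₀ = y₀
  poly : ∀ n, 1 ≤ n → n ≤ N → IsPolynomialOn s (Icc 0 (step t₀ T N)) (piece t₀ T N n σ)
  deriv : ∀ n, 1 ≤ n → n ≤ N → ∀ c ∈ Icc (0 : ℝ) 1,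
    HasDerivWithinAt (piece t₀ T N n σ)
      (∑ j ∈ Finset.range s,
        (legendre j).eval c • fourierCoeff f (step t₀ T N) j (piece t₀ T N n σ))
      (Icc 0 (step t₀ T N)) (c * step t₀ T N)

end HBVM

end

/-! Rescaled to [0,1], one step of the method reads u' = h Π_s F(u), with Π_s the L² projection onto
polynomials of degree below s, while the exact solution satisfies v' = h F(v). The error e = v - u
obeys e' = h (F(v) - F(u) + r). The defect r = F(u) - Π_s F(u) is orthogonal to all polynomials of
degree below s, and is O(h^s) as soon as e(0) is. Size alone gives a local error O(h^(s+1)) and, by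
a discrete Gronwall inequality, a global error O(h^s) (`IsStep.error_le`, `exists_error_le`).

Orthogonality doubles the order. Linearizing along y and truncating the Taylor expansion of f'(y)
gives e' = h (Σ (x h)^i a_i e + w + r) with w = O(h^(2s)). On integration r disappears, and e(1) -
e(0) involves e only through the moments ∫ x^i e. Integration by parts trades such a moment for e(1)
and h times moments of higher index; those of index at least s carry enough powers of h to be
estimated trivially (`exists_norm_increment_le`). The increment is thus O(h‖e(1)‖ + h^(2s+1)), with
no differentiation of the flow in its initial value, and a second Gronwall argument yields order 2s
(`IsStep.increment_le`, `exists_superconvergence`).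

Since f is only locally Lipschitz, it is replaced by a globally Lipschitz F equal to it on a ball.
Steps for F exist by contraction and are unique for small h; the O(h^s) bound then keeps the
approximation inside the ball, where F and f agree. -/

noncomputable section

namespace HBVM

variable {E : Type*} [NormedAddCommGroup E] [NormedSpace ℝ E]

/-! ### The truncated Legendre expansion -/

/-- The `L²` projection of `g` onto the polynomials of degree less than `s`, on `[0, 1]`. -/
def legendreProj (s : ℕ) (g : ℝ → E) (x : ℝ) : E :=
  ∑ j ∈ Finset.range s,
    (legendre j).eval x • ∫ ζ in (0 : ℝ)..1, (legendre j).eval ζ • g ζ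

/-- Since `legendre j` has degree exactly j, the first s of them span all polynomials of degree
below s. This turns orthogonality to the basis into vanishing of monomial moments. -/
theorem exists_pow_eq_sum_legendre {s i : ℕ} (hi : i < s) :
    ∃ c : ℕ → ℝ, ∀ x : ℝ, x ^ i = ∑ j ∈ Finset.range s, c j * (legendre j).eval x := by
  have h0 (j : ℕ) : legendre j ≠ 0 := by
    intro h
    have := integral_legendre_mul_self j
    simp [h] at this
  let S : Polynomial.Sequence ℝ :=
    ⟨legendre, fun j => by rw [Polynomial.degree_eq_natDegree (h0 j), natDegree_legendre]⟩
  have hspan := S.span_degreeLT (m := s)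
    (fun j _ => (Polynomial.leadingCoeff_ne_zero.2 (h0 j)).isUnit)
  have hmem : (Polynomial.X ^ i : Polynomial ℝ) ∈ Polynomial.degreeLT ℝ s := by
    rw [Polynomial.mem_degreeLT, Polynomial.degree_X_pow]
    exact_mod_cast hi
  rw [← hspan, ← Finset.coe_range, Submodule.mem_span_image_finset_iff_exists_fun'] at hmem
  obtain ⟨c, hc⟩ := hmem
  refine ⟨c, fun x => ?_⟩
  have := congrArg (Polynomial.eval x) hc
  simpa [Polynomial.eval_finsetSum, S] using this.symm

theorem exists_abs_eval_le (p : ℕ → Polynomial ℝ) (s : ℕ) :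
    ∃ B : ℝ, 0 ≤ B ∧ ∀ j ∈ Finset.range s, ∀ x ∈ Icc (0 : ℝ) 1, |(p j).eval x| ≤ B := by
  have h (j : ℕ) : ∃ B : ℝ, ∀ x ∈ Icc (0 : ℝ) 1, |(p j).eval x| ≤ B :=
    isCompact_Icc.exists_bound_of_continuousOn (p j).continuous.continuousOn
  choose B hB using h
  have hB0 (j : ℕ) : 0 ≤ B j := (abs_nonneg _).trans (hB j 0 (by simp))
  refine ⟨∑ j ∈ Finset.range s, B j, Finset.sum_nonneg fun j _ => hB0 j, fun j hj x hx => ?_⟩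
  exact (hB j x hx).trans (Finset.single_le_sum (fun j _ => hB0 j) hj)

theorem intervalIntegrable_smul {a : ℝ → ℝ} {g : ℝ → E} (ha : ContinuousOn a (Icc 0 1))
    (hg : ContinuousOn g (Icc 0 1)) :
    IntervalIntegrable (fun x => a x • g x) MeasureTheory.volume 0 1 :=
  (ha.smul hg).intervalIntegrable_of_Icc zero_le_one

theorem continuous_legendreProj (s : ℕ) (g : ℝ → E) : Continuous (legendreProj s g) := by
  unfold legendreProj
  exact continuous_finsetSum _ fun j _ => (legendre j).continuous.smul continuous_const

theorem norm_integral_le_of_norm_le_on {g : ℝ → E} {δ : ℝ}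
    (h : ∀ x ∈ Icc (0 : ℝ) 1, ‖g x‖ ≤ δ) : ‖∫ x in (0 : ℝ)..1, g x‖ ≤ δ := by
  have := intervalIntegral.norm_integral_le_of_norm_le_const (a := 0) (b := 1) (f := g) (C := δ)
    (fun x hx => h x (by
      rw [uIoc_of_le zero_le_one] at hx
      exact Ioc_subset_Icc_self hx))
  simpa using this

/-- The projection is Lipschitz for the maximum norm, with a constant depending only on `s`. -/
theorem exists_legendreProj_lipschitz (s : ℕ) :
    ∃ Λ : ℝ, 0 ≤ Λ ∧ ∀ (g g' : ℝ → E) (δ : ℝ), ContinuousOn g (Icc 0 1) →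
      ContinuousOn g' (Icc 0 1) → (∀ x ∈ Icc (0 : ℝ) 1, ‖g x - g' x‖ ≤ δ) →
      ∀ x ∈ Icc (0 : ℝ) 1, ‖legendreProj s g x - legendreProj s g' x‖ ≤ Λ * δ := by
  obtain ⟨B, hB0, hB⟩ := exists_abs_eval_le legendre s
  refine ⟨s * (B * B), by positivity, fun g g' δ hg hg' hd x hx => ?_⟩
  have hδ : 0 ≤ δ := (norm_nonneg _).trans (hd x hx)
  unfold legendreProj
  rw [← Finset.sum_sub_distrib]
  refine (norm_sum_le_of_le (n := fun _ => B * (B * δ)) _ fun j hj => ?_).trans_eq (by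
    simp; ring)
  rw [← smul_sub, ← intervalIntegral.integral_sub
    (intervalIntegrable_smul (legendre j).continuous.continuousOn hg)
    (intervalIntegrable_smul (legendre j).continuous.continuousOn hg'), norm_smul]
  refine mul_le_mul (hB j hj x hx) (norm_integral_le_of_norm_le_on fun ζ hζ => ?_)
    (norm_nonneg _) hB0
  rw [← smul_sub, norm_smul]
  exact mul_le_mul (hB j hj ζ hζ) (hd ζ hζ) (norm_nonneg _) hB0

theorem integral_legendre_smul_legendreProj [CompleteSpace E] {s j : ℕ} (hj : j < s) (g : ℝ → E) :
    ∫ x in (0 : ℝ)..1, (legendre j).eval x • legendreProj s g x =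
      ∫ x in (0 : ℝ)..1, (legendre j).eval x • g x := by
  unfold legendreProj
  simp only [Finset.smul_sum, smul_smul]
  rw [intervalIntegral.integral_finsetSum]
  swap
  · exact fun k _ => Continuous.intervalIntegrable (by fun_prop) _ _
  simp only [intervalIntegral.integral_smul_const, integral_legendre_mul_legendre]
  simp [hj]

/-- The moments of order less than `s` of `g` and of its projection agree. -/
theorem integral_pow_smul_sub_legendreProj [CompleteSpace E] {s i : ℕ} (hi : i < s) {g : ℝ → E}
    (hg : ContinuousOn g (Icc 0 1)) :
    ∫ x in (0 : ℝ)..1, x ^ i • (g x - legendreProj s g x) = 0 := by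
  obtain ⟨c, hc⟩ := exists_pow_eq_sum_legendre hi
  simp only [hc, Finset.sum_smul, mul_smul]
  have hr : ContinuousOn (fun x => g x - legendreProj s g x) (Icc 0 1) :=
    hg.sub (continuous_legendreProj s g).continuousOn
  rw [intervalIntegral.integral_finsetSum]
  swap
  · exact fun j _ =>
      (intervalIntegrable_smul (legendre j).continuous.continuousOn hr).smul (c j)
  refine Finset.sum_eq_zero fun j hj => ?_
  rw [intervalIntegral.integral_smul]
  simp only [smul_sub]
  rw [intervalIntegral.integral_sub
    (intervalIntegrable_smul (legendre j).continuous.continuousOn hg)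
    (intervalIntegrable_smul (legendre j).continuous.continuousOn
      (continuous_legendreProj s g).continuousOn),
    integral_legendre_smul_legendreProj (Finset.mem_range.1 hj), sub_self, smul_zero]

theorem legendreProj_pow_smul [CompleteSpace E] {s i : ℕ} (hi : i < s) (v : E) (x : ℝ) :
    legendreProj s (fun ζ => ζ ^ i • v) x = x ^ i • v := by
  obtain ⟨c, hc⟩ := exists_pow_eq_sum_legendre hi
  have h (j : ℕ) (hj : j ∈ Finset.range s) :
      ∫ ζ in (0 : ℝ)..1, (legendre j).eval ζ * ζ ^ i = c j := by
    simp only [hc, Finset.mul_sum]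
    rw [intervalIntegral.integral_finsetSum]
    swap
    · exact fun k _ => Continuous.intervalIntegrable (by fun_prop) _ _
    simp only [mul_left_comm _ (c _), intervalIntegral.integral_const_mul,
      integral_legendre_mul_legendre]
    simp [Finset.mem_range.1 hj]
  unfold legendreProj
  simp only [smul_smul, intervalIntegral.integral_smul_const]
  rw [hc x, Finset.sum_smul]
  refine Finset.sum_congr rfl fun j hj => ?_
  rw [h j hj, mul_comm]

theorem legendreProj_sum_pow_smul [CompleteSpace E] (s : ℕ) (b : ℕ → E) (x : ℝ) :
    legendreProj s (fun ζ => ∑ i ∈ Finset.range s, ζ ^ i • b i) x =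
      ∑ i ∈ Finset.range s, x ^ i • b i := by
  rw [← Finset.sum_congr rfl fun i hi => legendreProj_pow_smul (Finset.mem_range.1 hi) (b i) x]
  unfold legendreProj
  rw [Finset.sum_comm]
  refine Finset.sum_congr rfl fun j _ => ?_
  simp only [Finset.smul_sum]
  rw [intervalIntegral.integral_finsetSum]
  swap
  · exact fun k _ => Continuous.intervalIntegrable (by fun_prop) _ _
  rw [Finset.smul_sum]

/-! ### Error estimates on one subinterval, rescaled to `[0, 1]` -/

/-- `u` solves `u' = h Π_s F(u)` on `[0, 1]`, where `Π_s` is the truncated Legendre expansion. -/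
def IsStep (F : E → E) (h : ℝ) (s : ℕ) (u : ℝ → E) : Prop :=
  ∀ x ∈ Icc (0 : ℝ) 1,
    HasDerivWithinAt u (h • legendreProj s (fun ζ => F (u ζ)) x) (Icc 0 1) x

theorem IsStep.continuousOn {F : E → E} {h : ℝ} {s : ℕ} {u : ℝ → E} (hu : IsStep F h s u) :
    ContinuousOn u (Icc 0 1) := fun x hx => (hu x hx).continuousWithinAt

theorem norm_sub_le_of_norm_deriv_le {e e' : ℝ → E} {C : ℝ}
    (he : ∀ x ∈ Icc (0 : ℝ) 1, HasDerivWithinAt e (e' x) (Icc 0 1) x)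
    (hC : ∀ x ∈ Icc (0 : ℝ) 1, ‖e' x‖ ≤ C) {x : ℝ} (hx : x ∈ Icc (0 : ℝ) 1) :
    ‖e x - e 0‖ ≤ C := by
  have h := (convex_Icc (0 : ℝ) 1).norm_image_sub_le_of_norm_hasDerivWithin_le he hC
    (by simp : (0 : ℝ) ∈ Icc (0 : ℝ) 1) hx
  have hC0 : 0 ≤ C := (norm_nonneg _).trans (hC x hx)
  refine h.trans (mul_le_of_le_one_right hC0 ?_)
  rw [sub_zero, Real.norm_eq_abs, abs_of_nonneg hx.1]
  exact hx.2

theorem exists_forall_norm_le {G : Type*} [NormedAddCommGroup G] {e : ℝ → G} (he : ContinuousOn e (Icc 0 1)) :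
    ∃ x₀ ∈ Icc (0 : ℝ) 1, ∀ x ∈ Icc (0 : ℝ) 1, ‖e x‖ ≤ ‖e x₀‖ :=
  isCompact_Icc.exists_isMaxOn ⟨0, by simp⟩ he.norm

/-- The maximum S of the difference satisfies S ≤ h Λ L S, and h₀ is chosen to make h Λ L < 1/2. -/
theorem IsStep.eqOn (s : ℕ) (L : NNReal) :
    ∃ h₀ : ℝ, 0 < h₀ ∧ ∀ (F : E → E), LipschitzWith L F → ∀ h : ℝ, 0 < h → h ≤ h₀ →
      ∀ u u' : ℝ → E, IsStep F h s u → IsStep F h s u' → u 0 = u' 0 → EqOn u u' (Icc 0 1) := by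
  obtain ⟨Λ, hΛ0, hΛ⟩ := exists_legendreProj_lipschitz (E := E) s
  refine ⟨1 / (2 * (Λ * L + 1)), by positivity, fun F hF h hh hh0 u u' hu hu' h0 => ?_⟩
  obtain ⟨x₀, hx₀, hmax⟩ := exists_forall_norm_le (hu.continuousOn.sub hu'.continuousOn)
  set S := ‖(u - u') x₀‖ with hS
  have hd := hΛ (fun ζ => F (u ζ)) (fun ζ => F (u' ζ)) (L * S)
    (hF.continuous.comp_continuousOn hu.continuousOn)
    (hF.continuous.comp_continuousOn hu'.continuousOn)
    (fun x hx => (hF.norm_sub_le _ _).trans (by gcongr; exact hmax x hx))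
  have h1 := norm_sub_le_of_norm_deriv_le (C := h * (Λ * (L * S)))
    (fun x hx => (hu x hx).sub (hu' x hx)) (fun x hx => by
      rw [← smul_sub, norm_smul, Real.norm_of_nonneg hh.le]
      exact mul_le_mul_of_nonneg_left (hd x hx) hh.le) hx₀
  have h2 : S ≤ h * (Λ * (L * S)) := by
    simpa [h0, hS] using h1
  rw [le_div_iff₀ (by positivity)] at hh0
  have hS0 : 0 ≤ S := norm_nonneg _
  have h3 : S = 0 := by nlinarith
  intro x hx
  have := hmax x hx
  rw [h3] at this
  exact sub_eq_zero.1 (norm_le_zero_iff.1 this)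

/-- The projection fixes polynomials p of degree below s, so g - Π_s g = (g - p) - Π_s (g - p). With
p a Taylor polynomial of F(v), smoothness is needed only along the exact solution; F itself need
only be Lipschitz. -/
theorem IsStep.error_le [CompleteSpace E] (s : ℕ) (L : NNReal) {D : ℝ} (hD : 0 ≤ D) :
    ∃ K : ℝ, 0 ≤ K ∧ ∀ F : E → E, LipschitzWith L F → ∀ h : ℝ, 0 < h → h * K ≤ 1 / 2 →
      ∀ (u v : ℝ → E) (b : ℕ → E), IsStep F h s u →
      (∀ x ∈ Icc (0 : ℝ) 1, HasDerivWithinAt v (h • F (v x)) (Icc 0 1) x) →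
      (∀ x ∈ Icc (0 : ℝ) 1, ‖F (v x) - ∑ i ∈ Finset.range s, x ^ i • b i‖ ≤ D * h ^ s) →
      (∀ x ∈ Icc (0 : ℝ) 1, ‖v x - u x‖ ≤ 2 * ‖v 0 - u 0‖ + 2 * K * h ^ (s + 1)) ∧
      ‖v 1 - u 1‖ ≤ (1 + 2 * K * h) * ‖v 0 - u 0‖ + 2 * K * h ^ (s + 1) ∧
      ∀ x ∈ Icc (0 : ℝ) 1, ‖F (u x) - legendreProj s (fun ζ => F (u ζ)) x‖ ≤
        2 * K * (‖v 0 - u 0‖ + h ^ s) := by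
  obtain ⟨Λ, hΛ0, hΛ⟩ := exists_legendreProj_lipschitz (E := E) s
  -- This constant dominates L S + (1 + Λ) (L S + D h^s), the bound for F(v) - F(u) plus the defect.
  refine ⟨(2 + Λ) * (L + D), by positivity, fun F hF h hh hhK u v b hu hv hb => ?_⟩
  set K := (2 + Λ) * (L + D) with hKdef
  have hK : 0 ≤ K := by positivity
  have hvc : ContinuousOn v (Icc 0 1) := fun x hx => (hv x hx).continuousWithinAt
  obtain ⟨x₀, hx₀, hmax⟩ := exists_forall_norm_le (hvc.sub hu.continuousOn)
  simp only [Pi.sub_apply] at hmax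
  set S := ‖v x₀ - u x₀‖
  set e₀ := ‖v 0 - u 0‖
  have hS0 : 0 ≤ S := norm_nonneg _
  have he0 : 0 ≤ e₀ := norm_nonneg _
  have hhs : 0 < h ^ s := by positivity
  have hL : (0 : ℝ) ≤ L := L.2
  have hFe (x : ℝ) (hx : x ∈ Icc (0 : ℝ) 1) : ‖F (v x) - F (u x)‖ ≤ L * S :=
    (hF.norm_sub_le _ _).trans (by gcongr; exact hmax x hx)
  have hgp (x : ℝ) (hx : x ∈ Icc (0 : ℝ) 1) :
      ‖F (u x) - ∑ i ∈ Finset.range s, x ^ i • b i‖ ≤ L * S + D * h ^ s := by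
    rw [← sub_add_sub_cancel _ (F (v x))]
    refine (norm_add_le _ _).trans (add_le_add ?_ (hb x hx))
    rw [norm_sub_rev]
    exact hFe x hx
  have hproj := hΛ (fun ζ => F (u ζ)) (fun x => ∑ i ∈ Finset.range s, x ^ i • b i) _
    (hF.continuous.comp_continuousOn hu.continuousOn) (by fun_prop) hgp
  simp only [legendreProj_sum_pow_smul] at hproj
  have hr (x : ℝ) (hx : x ∈ Icc (0 : ℝ) 1) :
      ‖F (u x) - legendreProj s (fun ζ => F (u ζ)) x‖ ≤ (1 + Λ) * (L * S + D * h ^ s) := by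
    have := norm_sub_le (F (u x) - ∑ i ∈ Finset.range s, x ^ i • b i)
      (legendreProj s (fun ζ => F (u ζ)) x - ∑ i ∈ Finset.range s, x ^ i • b i)
    rw [sub_sub_sub_cancel_right] at this
    linarith [hgp x hx, hproj x hx]
  have hr' (x : ℝ) (hx : x ∈ Icc (0 : ℝ) 1) :
      ‖F (u x) - legendreProj s (fun ζ => F (u ζ)) x‖ ≤ K * (S + h ^ s) := by
    refine (hr x hx).trans ?_
    have h1 : 0 ≤ (1 + Λ) * (L * h ^ s + D * S) := by positivity
    have h2 : 0 ≤ (L + D) * (S + h ^ s) := by positivity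
    rw [hKdef]
    linarith
  have hder (x : ℝ) (hx : x ∈ Icc (0 : ℝ) 1) :
      ‖h • F (v x) - h • legendreProj s (fun ζ => F (u ζ)) x‖ ≤ h * (K * (S + h ^ s)) := by
    rw [← smul_sub, norm_smul, Real.norm_of_nonneg hh.le]
    refine mul_le_mul_of_nonneg_left ?_ hh.le
    rw [← sub_add_sub_cancel _ (F (u x))]
    refine (norm_add_le _ _).trans ((add_le_add (hFe x hx) (hr x hx)).trans ?_)
    have h1 : 0 ≤ (1 + Λ) * (L * h ^ s + D * S) := by positivity
    have h2 : 0 ≤ L * h ^ s + D * (S + h ^ s) := by positivity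
    rw [hKdef]
    linarith
  have hinc (x : ℝ) (hx : x ∈ Icc (0 : ℝ) 1) :
      ‖v x - u x‖ ≤ e₀ + h * (K * (S + h ^ s)) := by
    have h1 := norm_sub_le_of_norm_deriv_le (fun x hx => (hv x hx).sub (hu x hx)) hder hx
    simp only [Pi.sub_apply] at h1
    linarith [norm_sub_norm_le (v x - u x) (v 0 - u 0)]
  have hS : S ≤ 2 * e₀ + 2 * K * h ^ (s + 1) := by
    have h1 := hinc x₀ hx₀
    -- The maximum S occurs on both sides; h K ≤ 1/2 lets the left side absorb it.
    have h2 : h * K * S ≤ 1 / 2 * S := mul_le_mul_of_nonneg_right hhK hS0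
    rw [pow_succ]
    change S ≤ _ at h1
    linarith
  have h3 : h * K * h ^ s ≤ 1 / 2 * h ^ s := mul_le_mul_of_nonneg_right hhK hhs.le
  have hSh : S + h ^ s ≤ 2 * e₀ + 2 * h ^ s := by
    rw [pow_succ] at hS
    linarith
  refine ⟨fun x hx => (hmax x hx).trans hS, ?_, fun x hx => (hr' x hx).trans ?_⟩
  · have h1 := hinc 1 (by simp)
    have h2 := mul_le_mul_of_nonneg_left hSh (mul_nonneg hh.le hK)
    rw [pow_succ]
    linarith
  · have := mul_le_mul_of_nonneg_left hSh hK
    linarith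

/-! ### Moments of the error and superconvergence on one step -/

theorem norm_integral_pow_smul_le {g : ℝ → E} {δ : ℝ} (p : ℕ)
    (h : ∀ x ∈ Icc (0 : ℝ) 1, ‖g x‖ ≤ δ) : ‖∫ x in (0 : ℝ)..1, x ^ p • g x‖ ≤ δ := by
  refine norm_integral_le_of_norm_le_on fun x hx => ?_
  rw [norm_smul, norm_pow, Real.norm_of_nonneg hx.1]
  exact (mul_le_of_le_one_left (norm_nonneg _) (pow_le_one₀ hx.1 hx.2)).trans (h x hx)

/-- If `e' = h (∑ (x h)^i a_i e + w + r)` on `[0, 1]`, then the moments of `e'` are expressed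
through those of `e`, `w` and `r`. -/
theorem integral_pow_smul_deriv [CompleteSpace E] {s : ℕ} {e w r : ℝ → E} {a : ℕ → E →L[ℝ] E}
    {h : ℝ} (he : ContinuousOn e (Icc 0 1)) (hw : ContinuousOn w (Icc 0 1))
    (hr : ContinuousOn r (Icc 0 1)) (p : ℕ) :
    ∫ x in (0 : ℝ)..1,
        x ^ p • (h • (∑ i ∈ Finset.range s, (x * h) ^ i • a i (e x) + w x + r x)) =
      h • (∑ i ∈ Finset.range s, h ^ i • a i (∫ x in (0 : ℝ)..1, x ^ (p + i) • e x) +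
        (∫ x in (0 : ℝ)..1, x ^ p • w x) + ∫ x in (0 : ℝ)..1, x ^ p • r x) := by
  have hI (i : ℕ) (_ : i ∈ Finset.range s) : IntervalIntegrable
      (fun x => h ^ i • a i (x ^ (p + i) • e x)) MeasureTheory.volume 0 1 :=
    ContinuousOn.intervalIntegrable_of_Icc zero_le_one
      (((a i).continuous.comp_continuousOn (((continuous_pow (p + i)).continuousOn).smul he)
        ).const_smul (h ^ i))
  have hwI := intervalIntegrable_smul (continuous_pow p).continuousOn hw
  have hrI := intervalIntegrable_smul (continuous_pow p).continuousOn hr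
  have heq (x : ℝ) :
      x ^ p • (h • (∑ i ∈ Finset.range s, (x * h) ^ i • a i (e x) + w x + r x)) =
        h • (∑ i ∈ Finset.range s, h ^ i • a i (x ^ (p + i) • e x) + x ^ p • w x + x ^ p • r x) := by
    rw [smul_comm, smul_add (x ^ p), smul_add (x ^ p), Finset.smul_sum]
    refine congrArg (fun z => h • (z + x ^ p • w x + x ^ p • r x)) ?_
    refine Finset.sum_congr rfl fun i _ => ?_
    rw [map_smul, smul_smul, smul_smul]
    congr 1
    ring
  simp only [heq]
  have hsumI : IntervalIntegrable (fun x => ∑ i ∈ Finset.range s, h ^ i • a i (x ^ (p + i) • e x))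
      MeasureTheory.volume 0 1 := by
    simpa [Finset.sum_fn] using IntervalIntegrable.sum (Finset.range s) hI
  rw [intervalIntegral.integral_smul, intervalIntegral.integral_add _ hrI,
    intervalIntegral.integral_add _ hwI, intervalIntegral.integral_finsetSum hI]
  · congr 3
    refine Finset.sum_congr rfl fun i _ => ?_
    rw [intervalIntegral.integral_smul, (a i).intervalIntegral_comp_comm
      (intervalIntegrable_smul (continuous_pow (p + i)).continuousOn he)]
  · exact hsumI
  · exact hsumI.add hwI

/-- The increment of a solution of a perturbed linear equation is controlled by the final value
when the perturbation `r` is orthogonal to the polynomials of degree less than `s`. -/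
theorem exists_norm_increment_le [CompleteSpace E] {s : ℕ} (hs : 1 ≤ s) {D : ℝ} (hD : 0 ≤ D) :
    ∃ C : ℝ, 0 ≤ C ∧ ∀ (e w r : ℝ → E) (a : ℕ → E →L[ℝ] E) (h S W ρ : ℝ), 0 < h → h ≤ 1 →
      (∀ x ∈ Icc (0 : ℝ) 1, HasDerivWithinAt e
        (h • (∑ i ∈ Finset.range s, (x * h) ^ i • a i (e x) + w x + r x)) (Icc 0 1) x) →
      (∀ i, ‖a i‖ ≤ D) → ContinuousOn w (Icc 0 1) → ContinuousOn r (Icc 0 1) →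
      (∀ x ∈ Icc (0 : ℝ) 1, ‖e x‖ ≤ S) → (∀ x ∈ Icc (0 : ℝ) 1, ‖w x‖ ≤ W) →
      (∀ x ∈ Icc (0 : ℝ) 1, ‖r x‖ ≤ ρ) →
      (∀ i < s, ∫ x in (0 : ℝ)..1, x ^ i • r x = 0) →
      ‖e 1 - e 0‖ ≤ C * (h * ‖e 1‖ + h ^ (s + 1) * S + h * W + h ^ (s + 1) * ρ) := by
  -- Each integration by parts costs a factor 1 + s D: at most s of them are needed to reach index
  -- s, and one more factor comes from the final integration of e'.
  refine ⟨(1 + s * D) ^ (s + 1), by positivity, ?_⟩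
  intro e w r a h S W ρ hh hh1 he ha hwc hrc hS hW hρ hmom
  have hec : ContinuousOn e (Icc 0 1) := fun x hx => (he x hx).continuousWithinAt
  have h0mem : (0 : ℝ) ∈ Icc (0 : ℝ) 1 := by simp
  have hS0 : 0 ≤ S := (norm_nonneg _).trans (hS 0 h0mem)
  have hW0 : 0 ≤ W := (norm_nonneg _).trans (hW 0 h0mem)
  have hρ0 : 0 ≤ ρ := (norm_nonneg _).trans (hρ 0 h0mem)
  set B : ℝ := 1 + s * D with hB
  have hB1 : 1 ≤ B := by rw [hB]; nlinarith [mul_nonneg (Nat.cast_nonneg (α := ℝ) s) hD]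
  set Q := h * ‖e 1‖ + h ^ (s + 1) * S + h * W + h ^ (s + 1) * ρ with hQ
  have hQ1 : 0 ≤ h * ‖e 1‖ := by positivity
  have hQ2 : 0 ≤ h ^ (s + 1) * S := by positivity
  have hQ3 : 0 ≤ h * W := by positivity
  have hQ4 : 0 ≤ h ^ (s + 1) * ρ := by positivity
  have hQ0 : 0 ≤ Q := by positivity
  set M : ℕ → E := fun i => ∫ x in (0 : ℝ)..1, x ^ i • e x with hM
  -- Both sides equal ∫ x^p e'. For p = i + 1 this expresses (i + 1) M i through e(1) and moments of
  -- index above i; for p = 0 it is the increment itself.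
  have hparts (p : ℕ) : h • (∑ i ∈ Finset.range s, h ^ i • a i (M (p + i)) +
        (∫ x in (0 : ℝ)..1, x ^ p • w x) + ∫ x in (0 : ℝ)..1, x ^ p • r x) =
      e 1 - (0 : ℝ) ^ p • e 0 - ∫ x in (0 : ℝ)..1, (p * x ^ (p - 1)) • e x := by
    rw [← integral_pow_smul_deriv hec hwc hrc p]
    have hderc : ContinuousOn
        (fun x => h • (∑ i ∈ Finset.range s, (x * h) ^ i • a i (e x) + w x + r x)) (Icc 0 1) := by
      have (i : ℕ) : ContinuousOn (fun x => a i (e x)) (Icc 0 1) :=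
        (a i).continuous.comp_continuousOn hec
      fun_prop
    have := intervalIntegral.integral_smul_deriv_eq_deriv_smul_of_hasDerivWithinAt
      (a := 0) (b := 1) (u := fun x : ℝ => x ^ p) (u' := fun x : ℝ => p * x ^ (p - 1)) (v := e)
      (v' := fun x => h • (∑ i ∈ Finset.range s, (x * h) ^ i • a i (e x) + w x + r x))
      (fun x _ => (hasDerivAt_pow p x).hasDerivWithinAt)
      (by rw [uIcc_of_le zero_le_one]; exact he)
      (Continuous.intervalIntegrable (by fun_prop) _ _)
      (hderc.intervalIntegrable_of_Icc zero_le_one)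
    simpa using this
  have hbase (i : ℕ) (hi : s ≤ i) : h ^ (i + 1) * ‖M i‖ ≤ Q := by
    have h1 : h ^ (i + 1) ≤ h ^ (s + 1) := pow_le_pow_of_le_one hh.le hh1 (by omega)
    have h2 : ‖M i‖ ≤ S := norm_integral_pow_smul_le i hS
    have := mul_le_mul h1 h2 (norm_nonneg _) (by positivity)
    linarith
  have hsum (k p : ℕ) (hk : ∀ i, h ^ (p + i + 1) * ‖M (p + i)‖ ≤ B ^ k * Q) :
      h ^ p * ‖h • ∑ i ∈ Finset.range s, h ^ i • a i (M (p + i))‖ ≤ s * D * (B ^ k * Q) := by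
    rw [norm_smul, Real.norm_of_nonneg hh.le, ← mul_assoc]
    have h1 : ‖∑ i ∈ Finset.range s, h ^ i • a i (M (p + i))‖ ≤
        ∑ i ∈ Finset.range s, D * (h ^ i * ‖M (p + i)‖) := by
      refine norm_sum_le_of_le _ fun i _ => ?_
      rw [norm_smul, norm_pow, Real.norm_of_nonneg hh.le]
      have := ((a i).le_opNorm (M (p + i))).trans
        (mul_le_mul_of_nonneg_right (ha i) (norm_nonneg _))
      calc h ^ i * ‖a i (M (p + i))‖ ≤ h ^ i * (D * ‖M (p + i)‖) := by gcongr
        _ = _ := by ring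
    calc h ^ p * h * ‖∑ i ∈ Finset.range s, h ^ i • a i (M (p + i))‖
        ≤ h ^ p * h * ∑ i ∈ Finset.range s, D * (h ^ i * ‖M (p + i)‖) := by gcongr
      _ = ∑ i ∈ Finset.range s, D * (h ^ (p + i + 1) * ‖M (p + i)‖) := by
          rw [Finset.mul_sum]
          refine Finset.sum_congr rfl fun i _ => ?_
          ring
      _ ≤ ∑ i ∈ Finset.range s, D * (B ^ k * Q) := by
          exact Finset.sum_le_sum fun i _ => mul_le_mul_of_nonneg_left (hk i) hD
      _ = _ := by simp; ring
  -- Descending induction on the index, with k bounding the distance up to s. The weight h^(i+1)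
  -- makes the bound uniform in i: the factor h gained by integrating by parts pays for the rise of
  -- the index.
  have hmoment (k : ℕ) : ∀ i, s ≤ i + k → h ^ (i + 1) * ‖M i‖ ≤ B ^ k * Q := by
    induction k with
    | zero => intro i hi; simpa using hbase i hi
    | succ k ih =>
      intro i hi
      by_cases his : s ≤ i
      · exact (hbase i his).trans (le_mul_of_one_le_left hQ0 (one_le_pow₀ hB1))
      have h1 := hparts (i + 1)
      have h2 : (∫ x in (0 : ℝ)..1, ((i + 1 : ℕ) * x ^ (i + 1 - 1)) • e x) =
          ((i + 1 : ℕ) : ℝ) • M i := by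
        simp only [mul_smul, Nat.add_sub_cancel]
        rw [intervalIntegral.integral_smul]
      rw [h2, zero_pow (by omega), zero_smul, sub_zero, smul_add, smul_add, eq_sub_iff_add_eq,
        ← eq_sub_iff_add_eq'] at h1
      have hMle : ‖M i‖ ≤ ‖((i + 1 : ℕ) : ℝ) • M i‖ := by
        rw [norm_smul, Real.norm_of_nonneg (by positivity)]
        refine le_mul_of_one_le_left (norm_nonneg _) ?_
        exact_mod_cast (by omega : 1 ≤ i + 1)
      rw [h1] at hMle
      have hq : (h : ℝ) ^ (i + 1) ≤ h := by
        simpa using pow_le_pow_of_le_one hh.le hh1 (by omega : 1 ≤ i + 1)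
      have t1 : h ^ (i + 1) * ‖e 1‖ ≤ h * ‖e 1‖ := by gcongr
      have t2 := hsum k (i + 1) fun j => ih _ (by omega)
      have t3 : h ^ (i + 1) * ‖h • ∫ x in (0 : ℝ)..1, x ^ (i + 1) • w x‖ ≤ h * W := by
        rw [norm_smul, Real.norm_of_nonneg hh.le]
        have := norm_integral_pow_smul_le (i + 1) hW
        calc h ^ (i + 1) * (h * ‖∫ x in (0 : ℝ)..1, x ^ (i + 1) • w x‖)
            ≤ 1 * (h * W) := by
              gcongr
              exact pow_le_one₀ hh.le hh1
          _ = h * W := one_mul _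
      -- Orthogonality kills this moment unless i + 1 = s, where the weight is exactly h^(s+1).
      have t4 : h ^ (i + 1) * ‖h • ∫ x in (0 : ℝ)..1, x ^ (i + 1) • r x‖ ≤ h ^ (s + 1) * ρ := by
        by_cases hi1 : i + 1 < s
        · rw [hmom _ hi1]
          simpa using hQ4
        · rw [norm_smul, Real.norm_of_nonneg hh.le, ← mul_assoc, ← pow_succ]
          have := norm_integral_pow_smul_le (i + 1) hρ
          have h5 : i + 1 + 1 = s + 1 := by omega
          rw [h5] at *
          gcongr
      have hfin : h ^ (i + 1) * ‖M i‖ ≤ Q + s * D * (B ^ k * Q) := by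
        have := mul_le_mul_of_nonneg_left (hMle.trans ((norm_sub_le _ _).trans (add_le_add_right
          ((norm_add_le _ _).trans (add_le_add_left (norm_add_le _ _) _)) _)))
          (pow_nonneg hh.le (i + 1))
        linarith
      have hBk : Q ≤ B ^ k * Q := le_mul_of_one_le_left hQ0 (one_le_pow₀ hB1)
      calc h ^ (i + 1) * ‖M i‖ ≤ Q + s * D * (B ^ k * Q) := hfin
        _ ≤ B ^ k * Q + s * D * (B ^ k * Q) := by gcongr
        _ = B ^ (k + 1) * Q := by rw [hB]; ring
  have h1 := hparts 0
  simp only [pow_zero, one_smul, Nat.cast_zero, zero_mul, zero_smul,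
    intervalIntegral.integral_zero, sub_zero] at h1
  have h2 := hmom 0 (by omega)
  simp only [pow_zero, one_smul] at h2
  rw [h2, add_zero, smul_add] at h1
  have t2 := hsum s 0 fun i => hmoment s _ (by omega)
  have t3 : ‖h • ∫ x in (0 : ℝ)..1, w x‖ ≤ h * W := by
    rw [norm_smul, Real.norm_of_nonneg hh.le]
    gcongr
    exact norm_integral_le_of_norm_le_on hW
  rw [pow_zero, one_mul] at t2
  have hBk : Q ≤ B ^ s * Q := le_mul_of_one_le_left hQ0 (one_le_pow₀ hB1)
  rw [← h1]
  refine (norm_add_le _ _).trans ((add_le_add t2 t3).trans ?_)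
  have : B ^ (s + 1) * Q = B ^ s * Q + s * D * (B ^ s * Q) := by rw [hB]; ring
  linarith

/-- Superconvergence on one step, given that the initial error is `O(h^s)`. -/
theorem IsStep.increment_le [CompleteSpace E] {s : ℕ} (hs : 1 ≤ s) (L : NNReal) {D B c : ℝ}
    (hD : 0 ≤ D) (hB : 0 ≤ B) (hc : 0 ≤ c) :
    ∃ h₀ α β : ℝ, 0 < h₀ ∧ 0 ≤ α ∧ 0 ≤ β ∧ ∀ F : E → E, LipschitzWith L F →
      ∀ h : ℝ, 0 < h → h ≤ h₀ →
      ∀ (u v : ℝ → E) (b : ℕ → E) (A : ℝ → E →L[ℝ] E) (a : ℕ → E →L[ℝ] E), IsStep F h s u →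
      (∀ x ∈ Icc (0 : ℝ) 1, HasDerivWithinAt v (h • F (v x)) (Icc 0 1) x) →
      (∀ x ∈ Icc (0 : ℝ) 1, ‖F (v x) - ∑ i ∈ Finset.range s, x ^ i • b i‖ ≤ D * h ^ s) →
      (∀ i, ‖a i‖ ≤ D) →
      (∀ x ∈ Icc (0 : ℝ) 1, ‖A x - ∑ i ∈ Finset.range s, (x * h) ^ i • a i‖ ≤ D * h ^ s) →
      (∀ x ∈ Icc (0 : ℝ) 1, ‖F (v x) - F (u x) - A x (v x - u x)‖ ≤ B * ‖v x - u x‖ ^ 2) →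
      ‖v 0 - u 0‖ ≤ c * h ^ s →
      ‖(v 1 - u 1) - (v 0 - u 0)‖ ≤ α * h * ‖v 0 - u 0‖ + β * h ^ (2 * s + 1) := by
  obtain ⟨K, hK0, hK⟩ := IsStep.error_le (E := E) s L hD
  obtain ⟨C, hC0, hC⟩ := exists_norm_increment_le (E := E) hs hD
  set c₁ := 2 * c + 2 * K with hc₁
  have hc₁0 : 0 ≤ c₁ := by positivity
  set c₂ := B * c₁ ^ 2 + D * c₁ with hc₂
  have hc₂0 : 0 ≤ c₂ := by positivity
  set c₃ := 2 * K * (c + 1) with hc₃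
  have hc₃0 : 0 ≤ c₃ := by positivity
  refine ⟨min 1 (1 / (2 * (K + C + 1))), 2 * C, 2 * C * (c₁ + c₂ + c₃), by positivity,
    by positivity, by positivity, ?_⟩
  intro F hF h hh hh0 u v b A a hu hv hb ha hA hq he0
  have hh1 : h ≤ 1 := hh0.trans (min_le_left _ _)
  have hh2 := hh0.trans (min_le_right _ _)
  rw [le_div_iff₀ (by positivity)] at hh2
  have hhK : h * K ≤ 1 / 2 := by nlinarith [mul_nonneg hh.le hC0]
  have hhC : h * C ≤ 1 / 2 := by nlinarith [mul_nonneg hh.le hK0]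
  obtain ⟨hS, -, hρ⟩ := hK F hF h hh hhK u v b hu hv hb
  have hhs : 0 < h ^ s := by positivity
  have hvc : ContinuousOn v (Icc 0 1) := fun x hx => (hv x hx).continuousWithinAt
  have huc := hu.continuousOn
  have hFv := hF.continuous.comp_continuousOn hvc
  have hFu := hF.continuous.comp_continuousOn huc
  have hec : ContinuousOn (fun x => v x - u x) (Icc 0 1) := hvc.sub huc
  have hS' (x : ℝ) (hx : x ∈ Icc (0 : ℝ) 1) : ‖v x - u x‖ ≤ c₁ * h ^ s := by
    refine (hS x hx).trans ?_
    have : h ^ (s + 1) ≤ h ^ s := pow_le_pow_of_le_one hh.le hh1 (by omega)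
    have := mul_le_mul_of_nonneg_left this hK0
    rw [hc₁]
    linarith
  set P : ℝ → E →L[ℝ] E := fun x => ∑ i ∈ Finset.range s, (x * h) ^ i • a i with hP
  -- The perturbation w gathers the quadratic linearization remainder and the Taylor truncation of A
  -- applied to the error, both O(h^(2s)).
  set w : ℝ → E := fun x => F (v x) - F (u x) - P x (v x - u x) with hw
  set r : ℝ → E := fun x => F (u x) - legendreProj s (fun ζ => F (u ζ)) x with hr
  have hPc : Continuous P := by fun_prop
  have hwc : ContinuousOn w (Icc 0 1) :=
    (hFv.sub hFu).sub (hPc.continuousOn.clm_apply hec)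
  have hrc : ContinuousOn r (Icc 0 1) := hFu.sub (continuous_legendreProj s _).continuousOn
  have hw' (x : ℝ) (hx : x ∈ Icc (0 : ℝ) 1) : ‖w x‖ ≤ c₂ * (h ^ s * h ^ s) := by
    have h1 : w x = (F (v x) - F (u x) - A x (v x - u x)) + (A x - P x) (v x - u x) := by
      simp [hw]
    have h2 : ‖v x - u x‖ ^ 2 ≤ (c₁ * h ^ s) ^ 2 :=
      pow_le_pow_left₀ (norm_nonneg _) (hS' x hx) 2
    have h3 : ‖(A x - P x) (v x - u x)‖ ≤ (D * h ^ s) * (c₁ * h ^ s) :=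
      ((A x - P x).le_opNorm _).trans
        (mul_le_mul (hA x hx) (hS' x hx) (norm_nonneg _) (by positivity))
    have h4 := (hq x hx).trans (mul_le_mul_of_nonneg_left h2 hB)
    rw [h1]
    refine (norm_add_le _ _).trans ((add_le_add h4 h3).trans_eq ?_)
    rw [hc₂]
    ring
  have hr' (x : ℝ) (hx : x ∈ Icc (0 : ℝ) 1) : ‖r x‖ ≤ c₃ * h ^ s := by
    refine (hρ x hx).trans ?_
    have := mul_le_mul_of_nonneg_left he0 hK0
    rw [hc₃]
    linarith
  have hder (x : ℝ) (hx : x ∈ Icc (0 : ℝ) 1) : HasDerivWithinAt (fun x => v x - u x)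
      (h • (∑ i ∈ Finset.range s, (x * h) ^ i • a i (v x - u x) + w x + r x)) (Icc 0 1) x := by
    refine ((hv x hx).sub (hu x hx)).congr_deriv ?_
    rw [← smul_sub]
    congr 1
    simp [hw, hr, hP]
  have hmain := hC _ w r a h _ _ _ hh hh1 hder ha hwc hrc hS' hw' hr'
    (fun i hi => integral_pow_smul_sub_legendreProj hi hFu)
  set X := ‖(v 1 - u 1) - (v 0 - u 0)‖ with hX
  have hX1 : ‖v 1 - u 1‖ ≤ ‖v 0 - u 0‖ + X := by
    have := norm_add_le (v 0 - u 0) ((v 1 - u 1) - (v 0 - u 0))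
    rwa [add_sub_cancel] at this
  have h1 := mul_le_mul_of_nonneg_left hX1 (mul_nonneg hC0 hh.le)
  -- The term C h ‖e(1)‖ is at most C h ‖e(0)‖ + X / 2, so X is absorbed at the price of doubling
  -- the constants.
  have h2 := mul_le_mul_of_nonneg_right hhC (norm_nonneg _ : 0 ≤ X)
  have hpow : h ^ (2 * s + 1) = h * (h ^ s * h ^ s) := by ring
  rw [hpow]
  rw [pow_succ] at hmain
  linarith

/-! ### Linearization, Taylor expansion, regularity of solutions and discrete Gronwall -/

theorem norm_sub_sub_fderiv_le {f : E → E} (hf : ContDiff ℝ 2 f) {R : ℝ} {K : NNReal}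
    (hK : LipschitzOnWith K (fderiv ℝ f) (Metric.closedBall 0 R)) {p q : E}
    (hp : ‖p‖ ≤ R) (hq : ‖q‖ ≤ R) :
    ‖f p - f q - fderiv ℝ f p (p - q)‖ ≤ K * ‖p - q‖ ^ 2 := by
  have hsub : segment ℝ p q ⊆ Metric.closedBall 0 R :=
    (convex_closedBall 0 R).segment_subset (by simpa using hp) (by simpa using hq)
  have h := (convex_segment p q).norm_image_sub_le_of_norm_hasFDerivWithin_le'
    (f := f) (f' := fderiv ℝ f) (φ := fderiv ℝ f p) (C := K * ‖p - q‖)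
    (fun x _ => ((hf.differentiable (by norm_num)) x).hasFDerivAt.hasFDerivWithinAt)
    (fun x hx => (hK.norm_sub_le (hsub hx) (hsub (left_mem_segment ℝ p q))).trans (by
      have := norm_sub_le_of_mem_segment hx
      rw [norm_sub_rev p q]
      gcongr))
    (right_mem_segment ℝ p q) (left_mem_segment ℝ p q)
  rwa [mul_assoc, ← sq] at h

/-- Taylor expansion to the right of any point of `[a, b)`, with uniform constants. -/
theorem exists_taylor_bound {G : ℝ → E} {a b : ℝ} {s : ℕ} (hs : 1 ≤ s) (hab : a < b)
    (hG : ContDiffOn ℝ s G (Icc a b)) :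
    ∃ D : ℝ, 0 ≤ D ∧ ∀ x₀ ∈ Ico a b, ∃ c : ℕ → E, (∀ i, ‖c i‖ ≤ D) ∧
      ∀ t ∈ Icc x₀ b, ‖G t - ∑ i ∈ Finset.range s, (t - x₀) ^ i • c i‖ ≤ D * (t - x₀) ^ s := by
  have hbd (k : ℕ) : ∃ B : ℝ, k ≤ s →
      ∀ t ∈ Icc a b, ‖iteratedDerivWithin k G (Icc a b) t‖ ≤ B := by
    by_cases hk : k ≤ s
    · obtain ⟨B, hB⟩ := isCompact_Icc.exists_bound_of_continuousOn
        (hG.continuousOn_iteratedDerivWithin (m := k) (by exact_mod_cast hk)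
          (uniqueDiffOn_Icc hab))
      exact ⟨B, fun _ => hB⟩
    · exact ⟨0, fun h => absurd h hk⟩
  choose B hB using hbd
  have hB0 (k : ℕ) (hk : k ∈ Finset.range (s + 1)) : 0 ≤ B k :=
    (norm_nonneg _).trans (hB k (by simpa [Nat.lt_succ_iff] using hk) a (left_mem_Icc.2 hab.le))
  set D := ∑ k ∈ Finset.range (s + 1), B k with hD
  have hD0 : 0 ≤ D := Finset.sum_nonneg hB0
  have hBD (k : ℕ) (hk : k ≤ s) (t : ℝ) (ht : t ∈ Icc a b) :
      ‖iteratedDerivWithin k G (Icc a b) t‖ ≤ D :=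
    (hB k hk t ht).trans (Finset.single_le_sum hB0 (by simpa [Nat.lt_succ_iff] using hk))
  refine ⟨D, hD0, fun x₀ hx₀ => ?_⟩
  have hsub : Icc x₀ b ⊆ Icc a b := Icc_subset_Icc_left hx₀.1
  -- Taylor's formula is applied on [x₀, b], whereas the uniform bounds live on [a, b]; the
  -- derivatives agree because [x₀, b] is nondegenerate, which is why x₀ = b is excluded.
  have heq (k : ℕ) (hk : k ≤ s) (t : ℝ) (ht : t ∈ Icc x₀ b) :
      iteratedDerivWithin k G (Icc x₀ b) t = iteratedDerivWithin k G (Icc a b) t := by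
    rw [iteratedDerivWithin, iteratedDerivWithin, iteratedFDerivWithin_subset hsub
      (uniqueDiffOn_Icc hx₀.2) (uniqueDiffOn_Icc hab) (hG.of_le (by exact_mod_cast hk)) ht]
  have hfac (k : ℕ) : ((k.factorial : ℝ))⁻¹ ≤ 1 :=
    inv_le_one_of_one_le₀ (by exact_mod_cast k.factorial_pos)
  -- The coefficient bound is required for every index, so coefficients beyond s, which never enter
  -- the sum, are set to 0.
  refine ⟨fun k => if k ≤ s then ((k.factorial : ℝ))⁻¹ • iteratedDerivWithin k G (Icc a b) x₀
    else 0, fun i => ?_, fun t ht => ?_⟩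
  · dsimp only
    split_ifs with hi
    · rw [norm_smul, Real.norm_of_nonneg (by positivity)]
      exact (mul_le_of_le_one_left (norm_nonneg _) (hfac i)).trans
        (hBD i hi x₀ ⟨hx₀.1, hx₀.2.le⟩)
    · simpa using hD0
  · obtain ⟨n, rfl⟩ : ∃ n, s = n + 1 := ⟨s - 1, by omega⟩
    have h := taylor_mean_remainder_bound hx₀.2.le
      (by simpa using hG.mono hsub) ht (C := D) (fun t ht => by
        rw [heq _ le_rfl t ht]
        exact hBD _ le_rfl t (hsub ht))
    rw [taylor_within_apply] at h
    have h2 : ∑ i ∈ Finset.range (n + 1), (t - x₀) ^ i •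
        (if i ≤ n + 1 then ((i.factorial : ℝ))⁻¹ • iteratedDerivWithin i G (Icc a b) x₀ else 0) =
        ∑ k ∈ Finset.range (n + 1), ((k.factorial : ℝ)⁻¹ * (t - x₀) ^ k) •
          iteratedDerivWithin k G (Icc x₀ b) x₀ := by
      refine Finset.sum_congr rfl fun k hk => ?_
      have hk' : k ≤ n + 1 := (Finset.mem_range.1 hk).le
      rw [if_pos hk', heq k hk' x₀ (left_mem_Icc.2 hx₀.2.le), smul_smul, mul_comm]
    rw [h2]
    refine h.trans (div_le_self (mul_nonneg hD0 (pow_nonneg (by linarith [ht.1]) _)) ?_)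
    exact_mod_cast n.factorial_pos

/-- Bootstrap: if y is C^k, then so is y' = f(y), hence y is C^(k+1). -/
theorem IsODESolution.contDiffOn {f : E → E} {t₀ T : ℝ} {y₀ : E} {y : ℝ → E} (hT : t₀ < T)
    (hy : IsODESolution f t₀ T y₀ y) {n : ℕ} (hf : ContDiff ℝ n f) :
    ContDiffOn ℝ n y (Icc t₀ T) := by
  have key (k : ℕ) : k ≤ n → ContDiffOn ℝ k y (Icc t₀ T) := by
    induction k with
    | zero =>
      intro _
      exact contDiffOn_zero.2 fun t ht => (hy.deriv t ht).continuousWithinAt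
    | succ k ih =>
      intro hk
      have hu := uniqueDiffOn_Icc hT
      push_cast
      rw [contDiffOn_succ_iff_derivWithin hu]
      refine ⟨fun t ht => (hy.deriv t ht).differentiableWithinAt, by simp, ?_⟩
      exact ((hf.of_le (by exact_mod_cast (by omega : k ≤ n))).comp_contDiffOn
        (ih (by omega))).congr fun t ht => (hy.deriv t ht).derivWithin (hu t ht)
  exact key n le_rfl

theorem le_of_forall_succ_le_one_add_mul {e : ℕ → ℝ} {α β : ℝ} {N : ℕ} (hα : 0 ≤ α) (hβ : 0 ≤ β)
    (h0 : e 0 = 0) (h : ∀ n < N, e (n + 1) ≤ (1 + α) * e n + β) :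
    ∀ n ≤ N, e n ≤ n * β * Real.exp (n * α) := by
  intro n
  induction n with
  | zero => simp [h0]
  | succ n ih =>
    intro hn
    have h1 := ih (by omega)
    have h2 := h n (by omega)
    have h3 : 1 + α ≤ Real.exp α := by linarith [Real.add_one_le_exp α]
    have h4 : Real.exp ((n + 1 : ℕ) * α) = Real.exp α * Real.exp (n * α) := by
      rw [← Real.exp_add]
      push_cast
      ring_nf
    have h5 : 1 ≤ Real.exp ((n + 1 : ℕ) * α) := Real.one_le_exp (by positivity)
    have h6 : (1 + α) * e n ≤ Real.exp α * (n * β * Real.exp (n * α)) :=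
      (mul_le_mul_of_nonneg_left h1 (by linarith)).trans
        (mul_le_mul_of_nonneg_right h3 (by positivity))
    calc e (n + 1) ≤ (1 + α) * e n + β := h2
      _ ≤ Real.exp α * (n * β * Real.exp (n * α)) + β * Real.exp ((n + 1 : ℕ) * α) :=
          add_le_add h6 (le_mul_of_one_le_right hβ h5)
      _ = _ := by
          rw [h4]
          push_cast
          ring

/-! ### Solvability of one step -/

open Polynomial in
theorem exists_polynomial_primitive (p : ℝ[X]) :
    ∃ q : ℝ[X], derivative q = p ∧ q.eval 0 = 0 ∧ q.natDegree ≤ p.natDegree + 1 := by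
  refine ⟨∑ k ∈ Finset.range (p.natDegree + 1), monomial (k + 1) (p.coeff k / (k + 1)), ?_, ?_,
    natDegree_sum_le_of_forall_le _ _ fun k hk => (natDegree_monomial_le _).trans ?_⟩
  · conv_rhs => rw [p.as_sum_range]
    rw [derivative_sum]
    refine Finset.sum_congr rfl fun k _ => ?_
    rw [derivative_monomial]
    have : (k : ℝ) + 1 ≠ 0 := by positivity
    simp [div_mul_cancel₀ _ this]
  · simp [eval_finsetSum]
  · have := Finset.mem_range.1 hk
    omega

theorem IsPolynomialOn.comp_mul {s : ℕ} {z : ℝ → E} (hz : IsPolynomialOn s univ z) (k : ℝ) :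
    IsPolynomialOn s univ fun τ => z (τ * k) := by
  obtain ⟨a, ha⟩ := hz
  refine ⟨fun i => k ^ i • a i, fun τ _ => ?_⟩
  simp only [ha _ (mem_univ _), mul_pow, mul_smul]

/-- The fixed point is sought among the s Fourier coefficients γ_j rather than among functions: they
determine u through primitives of the Legendre polynomials, so u is automatically a polynomial of
degree at most s. The choice of h₀ gives contraction ratio 1/2. -/
theorem IsStep.exists_solution [FiniteDimensional ℝ E] (s : ℕ) (L : NNReal) :
    ∃ h₀ : ℝ, 0 < h₀ ∧ ∀ F : E → E, LipschitzWith L F → ∀ h : ℝ, 0 < h → h ≤ h₀ → ∀ y₀ : E,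
      ∃ u : ℝ → E, u 0 = y₀ ∧ IsStep F h s u ∧ IsPolynomialOn s univ u := by
  have : CompleteSpace E := FiniteDimensional.complete ℝ E
  choose Q hQd hQ0 hQdeg using fun j => exists_polynomial_primitive (legendre j)
  obtain ⟨B, hB0, hB⟩ := exists_abs_eval_le legendre s
  obtain ⟨B', hB'0, hB'⟩ := exists_abs_eval_le Q s
  refine ⟨1 / (2 * (B * L * B' * s + 1)), by positivity, fun F hF h hh hh0 y₀ => ?_⟩
  rw [le_div_iff₀ (by positivity)] at hh0
  let U : (Fin s → E) → ℝ → E := fun γ x => y₀ + ∑ j : Fin s, (h * (Q j).eval x) • γ j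
  have hUc (γ : Fin s → E) : Continuous (U γ) := by fun_prop
  let Γ : (Fin s → E) → Fin s → E := fun γ j =>
    ∫ ζ in (0 : ℝ)..1, (legendre j).eval ζ • F (U γ ζ)
  have hmem (j : Fin s) : (j : ℕ) ∈ Finset.range s := Finset.mem_range.2 j.2
  have hU (γ γ' : Fin s → E) (x : ℝ) (hx : x ∈ Icc (0 : ℝ) 1) :
      ‖F (U γ x) - F (U γ' x)‖ ≤ L * (s * (h * B' * ‖γ - γ'‖)) := by
    refine (hF.norm_sub_le _ _).trans ?_
    gcongr
    have : U γ x - U γ' x = ∑ j : Fin s, (h * (Q j).eval x) • (γ - γ') j := by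
      simp [U, smul_sub]
    rw [this]
    refine (norm_sum_le_of_le (n := fun _ => h * B' * ‖γ - γ'‖) _ fun j _ => ?_).trans_eq (by simp)
    rw [norm_smul, norm_mul, Real.norm_of_nonneg hh.le, Real.norm_eq_abs]
    have h1 := hB' j (hmem j) x hx
    have h2 := norm_le_pi_norm (γ - γ') j
    gcongr
  have hΓ : ContractingWith (1 / 2) Γ := by
    refine ⟨by
      rw [← NNReal.coe_lt_coe]
      norm_num, LipschitzWith.of_dist_le_mul fun γ γ' => ?_⟩
    rw [dist_eq_norm, dist_eq_norm]
    refine (pi_norm_le_iff_of_nonneg (by positivity)).2 fun j => ?_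
    have hc (γ : Fin s → E) : IntervalIntegrable (fun ζ => (legendre j).eval ζ • F (U γ ζ))
        MeasureTheory.volume 0 1 :=
      Continuous.intervalIntegrable
        ((legendre j).continuous.smul (hF.continuous.comp (hUc γ))) _ _
    have h1 : ‖(Γ γ - Γ γ') j‖ ≤ B * (L * (s * (h * B' * ‖γ - γ'‖))) := by
      simp only [Pi.sub_apply, Γ]
      rw [← intervalIntegral.integral_sub (hc γ) (hc γ')]
      refine norm_integral_le_of_norm_le_on fun ζ hζ => ?_
      rw [← smul_sub, norm_smul]
      exact mul_le_mul (hB j (hmem j) ζ hζ) (hU γ γ' ζ hζ) (norm_nonneg _) hB0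
    have h2 := mul_le_mul_of_nonneg_right hh0 (norm_nonneg (γ - γ'))
    have h3 : 0 ≤ h * ‖γ - γ'‖ := by positivity
    push_cast
    linarith
  set γ := ContractingWith.fixedPoint Γ hΓ with hγ
  have hfix : Γ γ = γ := hΓ.fixedPoint_isFixedPt
  refine ⟨U γ, by simp [U, hQ0], fun x _ => ?_, ?_⟩
  · have hd : HasDerivAt (U γ) (∑ j : Fin s, (h * (legendre j).eval x) • γ j) x := by
      refine HasDerivAt.const_add _ (HasDerivAt.fun_sum fun j _ => ?_)
      have := ((Q j).hasDerivAt x).const_mul h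
      rw [hQd] at this
      exact this.smul_const _
    refine (hd.congr_deriv ?_).hasDerivWithinAt
    rw [legendreProj, Finset.sum_range, Finset.smul_sum]
    refine Finset.sum_congr rfl fun j _ => ?_
    rw [mul_smul]
    exact congrArg (fun z => h • (legendre j).eval x • z) (congrFun hfix j).symm
  · refine ⟨fun k => (if k = 0 then y₀ else 0) + ∑ j : Fin s, (h * (Q j).coeff k) • γ j,
      fun x _ => ?_⟩
    simp only [smul_add, Finset.sum_add_distrib, Finset.smul_sum, U]
    congr 1
    · simp
    · rw [Finset.sum_comm]
      refine Finset.sum_congr rfl fun j _ => ?_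
      have hdeg : (Q j).natDegree < s + 1 := by
        have := hQdeg j
        rw [natDegree_legendre] at this
        omega
      rw [Polynomial.eval_eq_sum_range' hdeg, Finset.mul_sum, Finset.sum_smul]
      refine Finset.sum_congr rfl fun k _ => ?_
      rw [smul_smul]
      congr 1
      ring

/-! ### The mesh -/

theorem step_pos {t₀ T : ℝ} (hT : t₀ < T) {N : ℕ} (hN : 1 ≤ N) : 0 < step t₀ T N :=
  div_pos (sub_pos.2 hT) (by exact_mod_cast hN)

theorem exists_forall_step_le {t₀ T : ℝ} (hT : t₀ < T) {δ : ℝ} (hδ : 0 < δ) :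
    ∃ N₀ : ℕ, 1 ≤ N₀ ∧ ∀ N ≥ N₀, 0 < step t₀ T N ∧ step t₀ T N ≤ δ := by
  obtain ⟨N₀, hN₀⟩ := exists_nat_gt ((T - t₀) / δ)
  have hpos : 0 < (T - t₀) / δ := div_pos (sub_pos.2 hT) hδ
  have h1 : 1 ≤ N₀ := by
    have : (0 : ℝ) < N₀ := hpos.trans hN₀
    exact_mod_cast this
  refine ⟨N₀, h1, fun N hN => ⟨step_pos hT (h1.trans hN), ?_⟩⟩
  have h2 : (N₀ : ℝ) ≤ N := by exact_mod_cast hN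
  have h3 : (0 : ℝ) < N := (hpos.trans hN₀).trans_le h2
  rw [step, div_le_iff₀ h3, mul_comm]
  exact ((div_lt_iff₀ hδ).1 (hN₀.trans_le h2)).le

theorem nat_mul_step (t₀ T : ℝ) {N : ℕ} (hN : 1 ≤ N) : N * step t₀ T N = T - t₀ := by
  have : (N : ℝ) ≠ 0 := by positivity
  rw [step, mul_div_cancel₀ _ this]

theorem mesh_zero (t₀ T : ℝ) (N : ℕ) : mesh t₀ T N 0 = t₀ := by simp [mesh]

theorem mesh_succ (t₀ T : ℝ) (N n : ℕ) :
    mesh t₀ T N (n + 1) = mesh t₀ T N n + step t₀ T N := by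
  simp only [mesh]
  push_cast
  ring

theorem mesh_add_mem {t₀ T : ℝ} (hT : t₀ < T) {N n : ℕ} (hn : n < N) {x : ℝ}
    (hx : x ∈ Icc (0 : ℝ) 1) : mesh t₀ T N n + x * step t₀ T N ∈ Icc t₀ T := by
  have hh := step_pos hT (by omega : 1 ≤ N)
  have hN := nat_mul_step t₀ T (by omega : 1 ≤ N)
  have h1 : (n : ℝ) + 1 ≤ N := by exact_mod_cast hn
  have h2 : (n + x) * step t₀ T N ≤ N * step t₀ T N :=
    mul_le_mul_of_nonneg_right (by linarith [hx.2]) hh.le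
  have h3 : 0 ≤ (n + x) * step t₀ T N := mul_nonneg (add_nonneg n.cast_nonneg hx.1) hh.le
  simp only [mesh]
  constructor <;> linarith

theorem exists_eq_mesh_add {t₀ T : ℝ} (hT : t₀ < T) {N : ℕ} (hN : 1 ≤ N) {t : ℝ}
    (ht : t ∈ Icc t₀ T) :
    ∃ n < N, ∃ x ∈ Icc (0 : ℝ) 1, t = mesh t₀ T N n + x * step t₀ T N := by
  have hh := step_pos hT hN
  have hNh := nat_mul_step t₀ T hN
  have hq0 : 0 ≤ (t - t₀) / step t₀ T N := div_nonneg (sub_nonneg.2 ht.1) hh.le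
  have hqN : (t - t₀) / step t₀ T N ≤ N := by
    rw [div_le_iff₀ hh]
    linarith [ht.2]
  have hq : (t - t₀) / step t₀ T N * step t₀ T N = t - t₀ := div_mul_cancel₀ _ hh.ne'
  set q := (t - t₀) / step t₀ T N
  -- The index is ⌈q⌉ - 1, so that T falls in the last subinterval with x = 1; this leaves q = 0 as
  -- a separate case.
  rcases hq0.eq_or_lt with h0 | h0
  · refine ⟨0, hN, 0, by simp, ?_⟩
    rw [← h0, zero_mul] at hq
    rw [mesh_zero]
    linarith
  · have h1 : 0 < ⌈q⌉₊ := Nat.ceil_pos.2 h0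
    have h2 : ⌈q⌉₊ ≤ N := Nat.ceil_le.2 hqN
    have h3 := Nat.le_ceil q
    have h4 := Nat.ceil_lt_add_one h0.le
    have h5 : ((⌈q⌉₊ - 1 : ℕ) : ℝ) = ⌈q⌉₊ - 1 := by
      rw [Nat.cast_sub h1, Nat.cast_one]
    refine ⟨⌈q⌉₊ - 1, by omega, q - (⌈q⌉₊ - 1 : ℕ), ⟨by linarith, by linarith⟩, ?_⟩
    rw [mesh, sub_mul]
    linarith

/-! ### Approximations on the whole interval -/

theorem IsHBVMApprox.isStep {F : E → E} {t₀ T : ℝ} {y₀ : E} {s N : ℕ} {σ : ℝ → E}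
    (hT : t₀ < T) (hσ : IsHBVMApprox F t₀ T y₀ s N σ) {n : ℕ} (hn : n < N) :
    IsStep F (step t₀ T N) s fun x => σ (mesh t₀ T N n + x * step t₀ T N) := by
  intro x hx
  have hh := step_pos hT (by omega : 1 ≤ N)
  have h := hσ.deriv (n + 1) (by omega) hn x hx
  have h2 : HasDerivWithinAt (fun x : ℝ => x * step t₀ T N) (step t₀ T N) (Icc 0 1) x := by
    simpa using ((hasDerivAt_id x).mul_const (step t₀ T N)).hasDerivWithinAt
  have hmaps : MapsTo (fun x : ℝ => x * step t₀ T N) (Icc 0 1) (Icc 0 (step t₀ T N)) :=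
    fun z hz => ⟨mul_nonneg hz.1 hh.le, mul_le_of_le_one_left hh.le hz.2⟩
  have h3 := HasDerivWithinAt.scomp x (g₁ := piece t₀ T N (n + 1) σ) h h2 hmaps
  exact h3

/-- The method sees the vector field only along σ; this allows passage between f and its Lipschitz
extensions. -/
theorem IsHBVMApprox.congr {f F : E → E} {t₀ T : ℝ} {y₀ : E} {s N : ℕ} {σ : ℝ → E}
    (hT : t₀ < T) (hσ : IsHBVMApprox f t₀ T y₀ s N σ)
    (h : ∀ t ∈ Icc t₀ T, f (σ t) = F (σ t)) : IsHBVMApprox F t₀ T y₀ s N σ := by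
  refine ⟨hσ.initial, hσ.poly, fun n hn hnN c hc => ?_⟩
  have heq (j : ℕ) : fourierCoeff f (step t₀ T N) j (piece t₀ T N n σ) =
      fourierCoeff F (step t₀ T N) j (piece t₀ T N n σ) := by
    refine intervalIntegral.integral_congr fun ζ hζ => ?_
    rw [uIcc_of_le zero_le_one] at hζ
    simp only [piece]
    rw [h _ (mesh_add_mem hT (by omega) hζ)]
  simpa only [heq] using hσ.deriv n hn hnN c hc

theorem IsHBVMApprox.eqOn {F : E → E} {t₀ T : ℝ} {y₀ : E} {s N : ℕ} {σ σ' : ℝ → E}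
    (hT : t₀ < T) (hN : 1 ≤ N) (hσ : IsHBVMApprox F t₀ T y₀ s N σ)
    (hσ' : IsHBVMApprox F t₀ T y₀ s N σ')
    (huniq : ∀ u u' : ℝ → E, IsStep F (step t₀ T N) s u → IsStep F (step t₀ T N) s u' →
      u 0 = u' 0 → EqOn u u' (Icc 0 1)) : EqOn σ σ' (Icc t₀ T) := by
  have hpiece (n : ℕ) (hn : n < N) (h : σ (mesh t₀ T N n) = σ' (mesh t₀ T N n)) :=
    huniq _ _ (hσ.isStep hT hn) (hσ'.isStep hT hn) (by simpa using h)
  have hmesh (n : ℕ) : n ≤ N → σ (mesh t₀ T N n) = σ' (mesh t₀ T N n) := by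
    induction n with
    | zero => intro _; rw [mesh_zero, hσ.initial, hσ'.initial]
    | succ n ih =>
      intro hn
      simpa [mesh_succ] using hpiece n hn (ih (by omega)) (by simp : (1 : ℝ) ∈ Icc (0 : ℝ) 1)
  intro t ht
  obtain ⟨n, hn, x, hx, rfl⟩ := exists_eq_mesh_add hT hN ht
  exact hpiece n hn (hmesh n hn.le) hx

theorem IsHBVMApprox.exists_of_step {F : E → E} {t₀ T : ℝ} {s N : ℕ} (hT : t₀ < T) (hN : 1 ≤ N)
    (hsol : ∀ y₀ : E, ∃ u : ℝ → E, u 0 = y₀ ∧ IsStep F (step t₀ T N) s u ∧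
      IsPolynomialOn s univ u) (y₀ : E) :
    ∃ σ : ℝ → E, IsHBVMApprox F t₀ T y₀ s N σ := by
  have hh := step_pos hT hN
  choose U hU0 hUs hUp using hsol
  let Y : ℕ → E := fun n => Nat.rec y₀ (fun _ z => U z 1) n
  let σ : ℝ → E := fun t => U (Y ⌊(t - t₀) / step t₀ T N⌋₊)
    ((t - t₀) / step t₀ T N - ⌊(t - t₀) / step t₀ T N⌋₊)
  have hpiece (n : ℕ) : ∀ τ ∈ Icc 0 (step t₀ T N),
      piece t₀ T N (n + 1) σ τ = U (Y n) (τ * (step t₀ T N)⁻¹) := by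
    intro τ hτ
    have h1 : (mesh t₀ T N n + τ - t₀) / step t₀ T N = n + τ * (step t₀ T N)⁻¹ := by
      rw [mesh]
      field_simp
      ring
    simp only [piece, σ, Nat.add_sub_cancel]
    rw [h1]
    have h2 : 0 ≤ τ * (step t₀ T N)⁻¹ := mul_nonneg hτ.1 (inv_nonneg.2 hh.le)
    have h3 : τ * (step t₀ T N)⁻¹ ≤ 1 := by
      rw [← div_eq_mul_inv, div_le_one hh]
      exact hτ.2
    rw [add_comm (n : ℝ), Nat.floor_add_natCast h2, add_comm _ n]
    -- At the right end point the floor already selects the next piece, whose initial value is the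
    -- final value of the current one.
    rcases h3.eq_or_lt with h4 | h4
    · rw [h4]
      simp [hU0, Y, add_comm (1 : ℝ)]
    · rw [Nat.floor_eq_zero.2 h4]
      simp
  refine ⟨σ, ?_, fun n hn hnN => ?_, fun n hn hnN c hc => ?_⟩
  · simp [σ, hU0, Y]
  · obtain ⟨n, rfl⟩ : ∃ k, n = k + 1 := ⟨n - 1, by omega⟩
    obtain ⟨a, ha⟩ := (hUp (Y n)).comp_mul (step t₀ T N)⁻¹
    exact ⟨a, fun τ hτ => (hpiece n τ hτ).trans (ha τ (mem_univ τ))⟩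
  · obtain ⟨n, rfl⟩ : ∃ k, n = k + 1 := ⟨n - 1, by omega⟩
    have hcmem : c * step t₀ T N ∈ Icc 0 (step t₀ T N) :=
      ⟨mul_nonneg hc.1 hh.le, mul_le_of_le_one_left hh.le hc.2⟩
    have h1 := hUs (Y n) c hc
    have hcc : c * step t₀ T N * (step t₀ T N)⁻¹ = c := mul_inv_cancel_right₀ hh.ne' c
    have h2 : HasDerivWithinAt (fun τ : ℝ => τ * (step t₀ T N)⁻¹) (step t₀ T N)⁻¹
        (Icc 0 (step t₀ T N)) (c * step t₀ T N) := by
      simpa using ((hasDerivAt_id _).mul_const (step t₀ T N)⁻¹).hasDerivWithinAt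
    rw [← hcc] at h1
    have hmaps : MapsTo (fun τ : ℝ => τ * (step t₀ T N)⁻¹) (Icc 0 (step t₀ T N)) (Icc 0 1) :=
      fun τ hτ => ⟨mul_nonneg hτ.1 (inv_nonneg.2 hh.le), by
        beta_reduce
        rw [← div_eq_mul_inv, div_le_one hh]
        exact hτ.2⟩
    have h3 := HasDerivWithinAt.scomp (c * step t₀ T N) (g₁ := U (Y n)) h1 h2 hmaps
    refine (h3.congr (fun τ hτ => hpiece n τ hτ) (hpiece n _ hcmem)).congr_deriv ?_
    rw [hcc, smul_smul, inv_mul_cancel₀ hh.ne', one_smul, legendreProj]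
    refine Finset.sum_congr rfl fun j _ => congrArg _ ?_
    refine intervalIntegral.integral_congr fun ζ hζ => ?_
    rw [uIcc_of_le zero_le_one] at hζ
    rw [hpiece n _ ⟨mul_nonneg hζ.1 hh.le, mul_le_of_le_one_left hh.le hζ.2⟩,
      mul_inv_cancel_right₀ hh.ne']

/-! ### Convergence -/

theorem IsODESolution.hasDerivWithinAt_rescaled {f : E → E} {t₀ T : ℝ} {y₀ : E} {y : ℝ → E}
    (hT : t₀ < T) (hy : IsODESolution f t₀ T y₀ y) {N n : ℕ} (hn : n < N) {x : ℝ}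
    (hx : x ∈ Icc (0 : ℝ) 1) :
    HasDerivWithinAt (fun x => y (mesh t₀ T N n + x * step t₀ T N))
      (step t₀ T N • f (y (mesh t₀ T N n + x * step t₀ T N))) (Icc 0 1) x := by
  have h2 : HasDerivWithinAt (fun x : ℝ => mesh t₀ T N n + x * step t₀ T N) (step t₀ T N)
      (Icc 0 1) x := by
    simpa using (((hasDerivAt_id x).mul_const (step t₀ T N)).const_add (mesh t₀ T N n)).hasDerivWithinAt
  have hmaps : MapsTo (fun x : ℝ => mesh t₀ T N n + x * step t₀ T N) (Icc 0 1) (Icc t₀ T) :=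
    fun z hz => mesh_add_mem hT hn hz
  exact HasDerivWithinAt.scomp x (g₁ := y) (hy.deriv _ (mesh_add_mem hT hn hx)) h2 hmaps

theorem exists_taylor_bound_mesh {G : ℝ → E} {t₀ T : ℝ} {s : ℕ} (hs : 1 ≤ s) (hT : t₀ < T)
    (hG : ContDiffOn ℝ s G (Icc t₀ T)) :
    ∃ D : ℝ, 0 ≤ D ∧ ∀ N n : ℕ, n < N → ∃ c : ℕ → E, (∀ i, ‖c i‖ ≤ D) ∧
      ∀ x ∈ Icc (0 : ℝ) 1, ‖G (mesh t₀ T N n + x * step t₀ T N) -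
        ∑ i ∈ Finset.range s, (x * step t₀ T N) ^ i • c i‖ ≤ D * step t₀ T N ^ s := by
  obtain ⟨D, hD0, hD⟩ := exists_taylor_bound hs hT hG
  refine ⟨D, hD0, fun N n hn => ?_⟩
  have hh := step_pos hT (by omega : 1 ≤ N)
  have h0 := mesh_add_mem hT hn (x := 0) (by simp)
  have h1 := mesh_add_mem hT hn (x := 1) (by simp)
  rw [zero_mul, add_zero] at h0
  rw [one_mul] at h1
  obtain ⟨c, hc, hct⟩ := hD (mesh t₀ T N n) ⟨h0.1, by linarith [h1.2]⟩
  refine ⟨c, hc, fun x hx => ?_⟩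
  have hxh : 0 ≤ x * step t₀ T N := mul_nonneg hx.1 hh.le
  have h2 := hct (mesh t₀ T N n + x * step t₀ T N)
    ⟨by linarith, (mesh_add_mem hT hn hx).2⟩
  rw [add_sub_cancel_left] at h2
  refine h2.trans (mul_le_mul_of_nonneg_left ?_ hD0)
  exact pow_le_pow_left₀ hxh (mul_le_of_le_one_left hh.le hx.2) s

variable {f F : E → E} {t₀ T : ℝ} {y₀ : E} {y : ℝ → E} {s : ℕ} {L : NNReal}

/-- A first estimate, of order `s`, valid for a globally Lipschitz vector field. -/
theorem exists_error_le [CompleteSpace E] (hs : 1 ≤ s) (hf : ContDiff ℝ s f) (hT : t₀ < T)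
    (hy : IsODESolution f t₀ T y₀ y) (hF : LipschitzWith L F)
    (hFf : ∀ t ∈ Icc t₀ T, f (y t) = F (y t)) :
    ∃ (C : ℝ) (N₀ : ℕ), 0 ≤ C ∧ 1 ≤ N₀ ∧ ∀ N ≥ N₀, step t₀ T N ≤ 1 ∧
      ∀ σ : ℝ → E, IsHBVMApprox F t₀ T y₀ s N σ →
      (∀ n ≤ N, ‖y (mesh t₀ T N n) - σ (mesh t₀ T N n)‖ ≤ C * step t₀ T N ^ s) ∧
      (∀ n < N, ∀ x ∈ Icc (0 : ℝ) 1,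
        ‖y (mesh t₀ T N n + x * step t₀ T N) - σ (mesh t₀ T N n + x * step t₀ T N)‖ ≤
          2 * ‖y (mesh t₀ T N n) - σ (mesh t₀ T N n)‖ + C * step t₀ T N ^ (s + 1)) ∧
      ∀ t ∈ Icc t₀ T, ‖y t - σ t‖ ≤ C * step t₀ T N ^ s := by
  obtain ⟨D, hD0, hD⟩ := exists_taylor_bound_mesh hs hT
    (hf.comp_contDiffOn (hy.contDiffOn hT hf))
  obtain ⟨K, hK0, hK⟩ := IsStep.error_le (E := E) s L hD0
  obtain ⟨N₀, hN₀, hstep⟩ := exists_forall_step_le hT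
    (δ := min 1 (1 / (2 * (K + 1)))) (by positivity)
  set C₁ := (T - t₀) * (2 * K) * Real.exp (2 * K * (T - t₀)) with hC₁
  have hTt : 0 < T - t₀ := sub_pos.2 hT
  have hC₁0 : 0 ≤ C₁ := by positivity
  refine ⟨2 * C₁ + 2 * K, N₀, by positivity, hN₀, fun N hN => ?_⟩
  obtain ⟨hh, hle⟩ := hstep N hN
  have hh1 : step t₀ T N ≤ 1 := hle.trans (min_le_left _ _)
  have hh2 := hle.trans (min_le_right _ _)
  rw [le_div_iff₀ (by positivity)] at hh2
  have hN1 : 1 ≤ N := hN₀.trans hN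
  have hNh := nat_mul_step t₀ T hN1
  refine ⟨hh1, fun σ hσ => ?_⟩
  set h := step t₀ T N with hhdef
  have hpow : 0 < h ^ s := by positivity
  choose c _ hc using hD N
  have hpiece (n : ℕ) (hn : n < N) :=
    hK F hF h hh (by linarith) _ (fun x => y (mesh t₀ T N n + x * h))
      (fun i => h ^ i • c n hn i) (hσ.isStep hT hn)
      (fun x hx => by
        rw [← hFf _ (mesh_add_mem hT hn hx)]
        exact hy.hasDerivWithinAt_rescaled hT hn hx)
      (fun x hx => by
        rw [← hFf _ (mesh_add_mem hT hn hx)]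
        simpa only [Function.comp_apply, mul_pow, mul_smul] using hc n hn x hx)
  have hmesh (n : ℕ) (hn : n ≤ N) :
      ‖y (mesh t₀ T N n) - σ (mesh t₀ T N n)‖ ≤ C₁ * h ^ s := by
    have h1 := le_of_forall_succ_le_one_add_mul
      (e := fun n => ‖y (mesh t₀ T N n) - σ (mesh t₀ T N n)‖) (α := 2 * K * h)
      (β := 2 * K * h ^ (s + 1)) (N := N) (by positivity) (by positivity)
      (by simp [mesh_zero, hy.initial, hσ.initial])
      (fun n hn => by
        have := (hpiece n hn).2.1
        simpa [mesh_succ, ← hhdef] using this) n hn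
    have hnN : (n : ℝ) * h ≤ T - t₀ := by
      rw [← hNh]
      exact mul_le_mul_of_nonneg_right (by exact_mod_cast hn) hh.le
    refine h1.trans ?_
    calc (n : ℝ) * (2 * K * h ^ (s + 1)) * Real.exp (n * (2 * K * h))
        = (n * h) * (2 * K) * Real.exp (2 * K * (n * h)) * h ^ s := by ring_nf
      _ ≤ _ := by
        rw [hC₁]
        gcongr
  have hpiece' (n : ℕ) (hn : n < N) (x : ℝ) (hx : x ∈ Icc (0 : ℝ) 1) :
      ‖y (mesh t₀ T N n + x * h) - σ (mesh t₀ T N n + x * h)‖ ≤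
        2 * ‖y (mesh t₀ T N n) - σ (mesh t₀ T N n)‖ + 2 * K * h ^ (s + 1) := by
    simpa [← hhdef] using (hpiece n hn).1 x hx
  have hpow2 : h ^ (s + 1) ≤ h ^ s := pow_le_pow_of_le_one hh.le hh1 (by omega)
  refine ⟨fun n hn => (hmesh n hn).trans ?_, fun n hn x hx => (hpiece' n hn x hx).trans ?_,
    fun t ht => ?_⟩
  · gcongr
    linarith
  · gcongr
    linarith
  · obtain ⟨n, hn, x, hx, rfl⟩ := exists_eq_mesh_add hT hN1 ht
    have h1 := hpiece' n hn x hx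
    have h2 := hmesh n hn.le
    have h3 := mul_le_mul_of_nonneg_left hpow2 hK0
    linarith

theorem exists_superconvergence [CompleteSpace E] (hs : 1 ≤ s) (hf : ContDiff ℝ (s + 1 : ℕ) f)
    (hT : t₀ < T) (hy : IsODESolution f t₀ T y₀ y) (hF : LipschitzWith L F) {R : ℝ}
    (hFf : ∀ z, ‖z‖ ≤ R → f z = F z) {B : NNReal}
    (hB : LipschitzOnWith B (fderiv ℝ f) (Metric.closedBall 0 R))
    (hyR : ∀ t ∈ Icc t₀ T, ‖y t‖ ≤ R) :
    ∃ (C : ℝ) (N₀ : ℕ), ∀ N ≥ N₀, ∀ σ : ℝ → E, IsHBVMApprox F t₀ T y₀ s N σ →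
      (∀ t ∈ Icc t₀ T, ‖σ t‖ ≤ R) →
      (∀ n < N, ‖(y (mesh t₀ T N (n + 1)) - σ (mesh t₀ T N (n + 1))) -
          (y (mesh t₀ T N n) - σ (mesh t₀ T N n))‖ ≤ C * step t₀ T N ^ (2 * s + 1) ∧
        ∀ x ∈ Icc (0 : ℝ) 1,
          ‖y (mesh t₀ T N n + x * step t₀ T N) - σ (mesh t₀ T N n + x * step t₀ T N)‖ ≤
            C * step t₀ T N ^ (s + 1)) ∧
      ∀ n ≤ N, ‖y (mesh t₀ T N n) - σ (mesh t₀ T N n)‖ ≤ C * step t₀ T N ^ (2 * s) := by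
  have hfs : ContDiff ℝ s f := hf.of_le (by exact_mod_cast Nat.le_succ s)
  have hf2 : ContDiff ℝ 2 f := hf.of_le (by exact_mod_cast (by omega : 2 ≤ s + 1))
  have hyc := hy.contDiffOn hT hfs
  have hFy (t : ℝ) (ht : t ∈ Icc t₀ T) : f (y t) = F (y t) := hFf _ (hyR t ht)
  obtain ⟨C₀, N₀, hC₀, hN₀, hcrude⟩ := exists_error_le hs hfs hT hy hF hFy
  obtain ⟨D₁, hD₁0, hD₁⟩ := exists_taylor_bound_mesh hs hT (hfs.comp_contDiffOn hyc)
  obtain ⟨D₂, hD₂0, hD₂⟩ := exists_taylor_bound_mesh hs hT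
    ((hf.fderiv_right (m := s) (by push_cast; exact le_rfl)).comp_contDiffOn hyc)
  obtain ⟨h₀, α, β, hh₀, hα, hβ, hinc⟩ := IsStep.increment_le (E := E) hs L
    (add_nonneg hD₁0 hD₂0) B.2 hC₀
  obtain ⟨N₁, -, hstep⟩ := exists_forall_step_le hT hh₀
  have hTt : 0 < T - t₀ := sub_pos.2 hT
  set C₁ := (T - t₀) * β * Real.exp (α * (T - t₀)) with hC₁
  have hC₁0 : 0 ≤ C₁ := by positivity
  -- The three groups serve the increment, the uniform error on a subinterval and the mesh error.
  refine ⟨α * C₁ + β + (2 * C₁ + C₀) + C₁, max N₀ N₁, fun N hN σ hσ hσR => ?_⟩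
  obtain ⟨hh1, hcr⟩ := hcrude N ((le_max_left _ _).trans hN)
  obtain ⟨hh, hle⟩ := hstep N ((le_max_right _ _).trans hN)
  have hN1 : 1 ≤ N := hN₀.trans ((le_max_left _ _).trans hN)
  have hNh := nat_mul_step t₀ T hN1
  obtain ⟨hmesh0, hpiece0, -⟩ := hcr σ hσ
  set h := step t₀ T N with hhdef
  have hpow : 0 < h ^ s := by positivity
  have hstepinc (n : ℕ) (hn : n < N) :
      ‖(y (mesh t₀ T N (n + 1)) - σ (mesh t₀ T N (n + 1))) -
        (y (mesh t₀ T N n) - σ (mesh t₀ T N n))‖ ≤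
      α * h * ‖y (mesh t₀ T N n) - σ (mesh t₀ T N n)‖ + β * h ^ (2 * s + 1) := by
    obtain ⟨c, -, hc⟩ := hD₁ N n hn
    obtain ⟨a, ha, hA⟩ := hD₂ N n hn
    have hmem (x : ℝ) (hx : x ∈ Icc (0 : ℝ) 1) := mesh_add_mem hT hn hx
    have := hinc F hF h hh hle (fun x => σ (mesh t₀ T N n + x * h))
      (fun x => y (mesh t₀ T N n + x * h)) (fun i => h ^ i • c i)
      (fun x => fderiv ℝ f (y (mesh t₀ T N n + x * h))) a (hσ.isStep hT hn)
      (fun x hx => by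
        rw [← hFy _ (hmem x hx)]
        exact hy.hasDerivWithinAt_rescaled hT hn hx)
      (fun x hx => by
        rw [← hFy _ (hmem x hx)]
        refine le_trans ?_ (mul_le_mul_of_nonneg_right (le_add_of_nonneg_right hD₂0) hpow.le)
        simpa only [Function.comp_apply, mul_pow, mul_smul] using hc x hx)
      (fun i => (ha i).trans (le_add_of_nonneg_left hD₁0))
      (fun x hx => (hA x hx).trans
        (mul_le_mul_of_nonneg_right (le_add_of_nonneg_left hD₁0) hpow.le))
      (fun x hx => by
        rw [← hFy _ (hmem x hx), ← hFf _ (hσR _ (hmem x hx))]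
        exact norm_sub_sub_fderiv_le hf2 hB (hyR _ (hmem x hx)) (hσR _ (hmem x hx)))
      -- The crude global bound supplies the O(h^s) initial error that the one-step estimate
      -- presupposes.
      (by simpa using hmesh0 n hn.le)
    simpa [mesh_succ, ← hhdef] using this
  have hmesh (n : ℕ) (hn : n ≤ N) :
      ‖y (mesh t₀ T N n) - σ (mesh t₀ T N n)‖ ≤ C₁ * h ^ (2 * s) := by
    have h1 := le_of_forall_succ_le_one_add_mul
      (e := fun n => ‖y (mesh t₀ T N n) - σ (mesh t₀ T N n)‖) (α := α * h)
      (β := β * h ^ (2 * s + 1)) (N := N) (by positivity) (by positivity)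
      (by simp [mesh_zero, hy.initial, hσ.initial])
      (fun n hn => by
        have h1 := hstepinc n hn
        have h2 := norm_le_norm_add_norm_sub' (y (mesh t₀ T N (n + 1)) - σ (mesh t₀ T N (n + 1)))
          (y (mesh t₀ T N n) - σ (mesh t₀ T N n))
        linarith) n hn
    have hnN : (n : ℝ) * h ≤ T - t₀ := by
      rw [← hNh]
      exact mul_le_mul_of_nonneg_right (by exact_mod_cast hn) hh.le
    refine h1.trans ?_
    calc (n : ℝ) * (β * h ^ (2 * s + 1)) * Real.exp (n * (α * h))
        = (n * h) * β * Real.exp (α * (n * h)) * h ^ (2 * s) := by ring_nf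
      _ ≤ _ := by
        rw [hC₁]
        gcongr
  have hαC : 0 ≤ α * C₁ := by positivity
  refine ⟨fun n hn => ⟨?_, fun x hx => ?_⟩, fun n hn => (hmesh n hn).trans ?_⟩
  · have h1 := mul_le_mul_of_nonneg_left (hmesh n hn.le) (mul_nonneg hα hh.le)
    have h2 : 0 ≤ (2 * C₁ + C₀ + C₁) * h ^ (2 * s + 1) := by positivity
    have h3 : α * h * (C₁ * h ^ (2 * s)) = α * C₁ * h ^ (2 * s + 1) := by ring
    linarith [hstepinc n hn]
  · have h1 := hpiece0 n hn x hx
    have h2 := hmesh n hn.le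
    have h3 : h ^ (2 * s) ≤ h ^ (s + 1) := pow_le_pow_of_le_one hh.le hh1 (by omega)
    have h4 := mul_le_mul_of_nonneg_left h3 hC₁0
    have h5 : 0 ≤ (α * C₁ + β + C₁) * h ^ (s + 1) := by positivity
    linarith
  · gcongr
    linarith

theorem exists_lipschitz_extension [FiniteDimensional ℝ E] (hf : ContDiff ℝ 1 f) (R : ℝ) :
    ∃ (L : NNReal) (F : E → E), LipschitzWith L F ∧ ∀ z, ‖z‖ ≤ R → f z = F z := by
  have : ProperSpace E := FiniteDimensional.proper_real E
  obtain ⟨K, hK⟩ := hf.contDiffOn.exists_lipschitzOnWith one_ne_zero (convex_closedBall 0 R)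
    (isCompact_closedBall (0 : E) R)
  obtain ⟨F, hF, hfF⟩ := hK.extend_finite_dimension
  exact ⟨_, F, hF, fun z hz => hfF (by simpa using hz)⟩

end HBVM

end

/-! ### Localization and conclusion -/

theorem mainTheorem1 {E : Type*} [NormedAddCommGroup E] [NormedSpace ℝ E] [FiniteDimensional ℝ E]
    (s : ℕ) (hs : 1 ≤ s) (f : E → E) (hf : ContDiff ℝ ((s + 1 : ℕ)) f)
    (t₀ T : ℝ) (hT : t₀ < T) (y₀ : E) (y : ℝ → E) (hy : HBVM.IsODESolution f t₀ T y₀ y) :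
    ∃ C : ℝ, ∀ R : ℝ, (∀ t ∈ Set.Icc t₀ T, ‖y t‖ < R) → ∃ N₀ : ℕ, ∀ N : ℕ, N₀ ≤ N →
      -- existence of the approximation with values in the ball of radius `R`
      (∃ σ : ℝ → E, HBVM.IsHBVMApprox f t₀ T y₀ s N σ ∧ ∀ t ∈ Set.Icc t₀ T, ‖σ t‖ ≤ R) ∧
      -- its uniqueness
      (∀ σ σ' : ℝ → E,
        HBVM.IsHBVMApprox f t₀ T y₀ s N σ → (∀ t ∈ Set.Icc t₀ T, ‖σ t‖ ≤ R) →
        HBVM.IsHBVMApprox f t₀ T y₀ s N σ' → (∀ t ∈ Set.Icc t₀ T, ‖σ' t‖ ≤ R) →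
        Set.EqOn σ σ' (Set.Icc t₀ T)) ∧
      ∀ σ : ℝ → E, HBVM.IsHBVMApprox f t₀ T y₀ s N σ → (∀ t ∈ Set.Icc t₀ T, ‖σ t‖ ≤ R) →
        -- propagation of the error at the mesh points, and uniform error on each subinterval
        (∀ n : ℕ, 1 ≤ n → n ≤ N →
          ‖(y (HBVM.mesh t₀ T N n) - σ (HBVM.mesh t₀ T N n)) -
              (y (HBVM.mesh t₀ T N (n - 1)) - σ (HBVM.mesh t₀ T N (n - 1)))‖
            ≤ C * HBVM.step t₀ T N ^ (2 * s + 1) ∧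
          ∀ c ∈ Set.Icc (0 : ℝ) 1,
            ‖HBVM.piece t₀ T N n y (c * HBVM.step t₀ T N) -
                HBVM.piece t₀ T N n σ (c * HBVM.step t₀ T N)‖
              ≤ C * HBVM.step t₀ T N ^ (s + 1)) ∧
        -- the first step
        (‖y (HBVM.mesh t₀ T N 1) - σ (HBVM.mesh t₀ T N 1)‖
            ≤ C * HBVM.step t₀ T N ^ (2 * s + 1)) ∧
        -- order `2 s` at the mesh points
        (∀ n : ℕ, n ≤ N →
          ‖y (HBVM.mesh t₀ T N n) - σ (HBVM.mesh t₀ T N n)‖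
            ≤ C * HBVM.step t₀ T N ^ (2 * s)) := by
  have : ProperSpace E := FiniteDimensional.proper_real E
  have hf1 : ContDiff ℝ 1 f := hf.of_le (by exact_mod_cast (by omega : 1 ≤ s + 1))
  have hf2 : ContDiff ℝ 2 f := hf.of_le (by exact_mod_cast (by omega : 2 ≤ s + 1))
  have hfs : ContDiff ℝ s f := hf.of_le (by exact_mod_cast Nat.le_succ s)
  have hyc : ContinuousOn y (Set.Icc t₀ T) := fun t ht => (hy.deriv t ht).continuousWithinAt
  obtain ⟨τ, hτ, hmax⟩ := isCompact_Icc.exists_isMaxOn (Set.nonempty_Icc.2 hT.le) hyc.norm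
  set M := ‖y τ‖ with hM
  have hyM : ∀ t ∈ Set.Icc t₀ T, ‖y t‖ ≤ M := hmax
  -- The fine estimate uses the ball of radius M + 1, fixed before R is given, so that C does not
  -- depend on R. The extension for radius R serves existence, uniqueness and confinement, and
  -- affects only the threshold on N.
  obtain ⟨L₁, F₁, hF₁, hfF₁⟩ := HBVM.exists_lipschitz_extension hf1 (M + 1)
  obtain ⟨B, hB⟩ := (hf2.fderiv_right (m := 1) (by norm_num)).contDiffOn.exists_lipschitzOnWith
    one_ne_zero (convex_closedBall 0 (M + 1)) (isCompact_closedBall (0 : E) (M + 1))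
  obtain ⟨C, N₁, hfine⟩ := HBVM.exists_superconvergence hs hf hT hy hF₁ hfF₁ hB
    (fun t ht => (hyM t ht).trans (by linarith))
  refine ⟨C, fun R hR => ?_⟩
  have hMR : M < R := hR τ hτ
  obtain ⟨L, F, hF, hfF⟩ := HBVM.exists_lipschitz_extension hf1 R
  obtain ⟨C', N₂, hC', hN₂, hcrude⟩ := HBVM.exists_error_le hs hfs hT hy hF
    (fun t ht => hfF _ (hR t ht).le)
  obtain ⟨h₁, hh₁, huniq⟩ := HBVM.IsStep.eqOn (E := E) s L
  obtain ⟨h₂, hh₂, hsol⟩ := HBVM.IsStep.exists_solution (E := E) s L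
  -- With this step bound the crude error is at most min 1 (R - M), which keeps σ inside both balls,
  -- of radius R and M + 1.
  have hδ : 0 < min 1 (R - M) / (C' + 1) :=
    div_pos (lt_min one_pos (sub_pos.2 hMR)) (by positivity)
  obtain ⟨N₃, -, hstep⟩ := HBVM.exists_forall_step_le hT (lt_min (lt_min hh₁ hh₂) hδ)
  refine ⟨max N₁ (max N₂ N₃), fun N hN => ?_⟩
  have hNN₁ : N₁ ≤ N := (le_max_left _ _).trans hN
  have hNN₂ : N₂ ≤ N := (le_max_left _ _).trans ((le_max_right _ _).trans hN)
  have hN1 : 1 ≤ N := hN₂.trans hNN₂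
  obtain ⟨hh, hle⟩ := hstep N ((le_max_right _ _).trans ((le_max_right _ _).trans hN))
  obtain ⟨hone, hcr⟩ := hcrude N hNN₂
  have hle₁ := hle.trans ((min_le_left _ _).trans (min_le_left _ _))
  have hle₂ := hle.trans ((min_le_left _ _).trans (min_le_right _ _))
  have hle₃ := hle.trans (min_le_right _ _)
  rw [le_div_iff₀ (by positivity)] at hle₃
  have hsmall : C' * HBVM.step t₀ T N ^ s ≤ min 1 (R - M) := by
    have h1 : HBVM.step t₀ T N ^ s ≤ HBVM.step t₀ T N := by
      simpa using pow_le_pow_of_le_one hh.le hone hs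
    have h2 := mul_le_mul_of_nonneg_left h1 hC'
    linarith
  have hnear (σ : ℝ → E) (hσ : HBVM.IsHBVMApprox F t₀ T y₀ s N σ) (t : ℝ)
      (ht : t ∈ Set.Icc t₀ T) : ‖σ t‖ ≤ M + min 1 (R - M) := by
    have h1 := (hcr σ hσ).2.2 t ht
    have h2 := norm_le_norm_add_norm_sub (y t) (σ t)
    linarith [hyM t ht]
  have hFapprox (σ : ℝ → E) (hσ : HBVM.IsHBVMApprox f t₀ T y₀ s N σ)
      (hσR : ∀ t ∈ Set.Icc t₀ T, ‖σ t‖ ≤ R) : HBVM.IsHBVMApprox F t₀ T y₀ s N σ :=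
    hσ.congr hT fun t ht => hfF _ (hσR t ht)
  refine ⟨?_, fun σ σ' hσ hσR hσ' hσ'R => ?_, fun σ hσ hσR => ?_⟩
  · obtain ⟨σ, hσ⟩ := HBVM.IsHBVMApprox.exists_of_step hT hN1 (hsol F hF _ hh hle₂) y₀
    have hσR : ∀ t ∈ Set.Icc t₀ T, ‖σ t‖ ≤ R := fun t ht =>
      (hnear σ hσ t ht).trans (by linarith [min_le_right 1 (R - M)])
    exact ⟨σ, hσ.congr hT fun t ht => (hfF _ (hσR t ht)).symm, hσR⟩
  · exact (hFapprox σ hσ hσR).eqOn hT hN1 (hFapprox σ' hσ' hσ'R) (huniq F hF _ hh hle₁)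
  -- Even when R exceeds M + 1, an approximation bounded by R lies in the smaller ball, so it is
  -- also an approximation for F₁.
  · have hσM : ∀ t ∈ Set.Icc t₀ T, ‖σ t‖ ≤ M + 1 := fun t ht =>
      (hnear σ (hFapprox σ hσ hσR) t ht).trans (by linarith [min_le_left 1 (R - M)])
    obtain ⟨hinc, hord⟩ := hfine N hNN₁ σ (hσ.congr hT fun t ht => hfF₁ _ (hσM t ht)) hσM
    refine ⟨fun n hn hnN => ?_, ?_, hord⟩
    · obtain ⟨k, rfl⟩ : ∃ k, n = k + 1 := ⟨n - 1, by omega⟩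
      exact hinc k hnN
    · simpa [HBVM.mesh_zero, hy.initial, hσ.initial] using (hinc 0 hN1).1
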